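/- Let $f:\mathbb R\to\mathbb C$ be $2\pi$-periodic and integrable over a period, and write $\|g\|=\int_{-\pi}^{\pi}|g(x)|\,dx$, $\hat f(k)=\frac1{2\pi}\int_{-\pi}^{\pi}f(x)e^{-ikx}\,dx$ for $k\in\mathbb Z$, and $S_n(f,x)=\sum_{k=-n}^{n}\hat f(k)e^{ikx}$. A complex sequence $\mathbf c=\{c_n\}_{n\ge 1}$ belongs to the class $\mathrm{GBV}$ if there is $\theta\in[0,\pi/2)$ with $|\arg c_n|\le\theta$ for all $n\ge1$ (the value $c_n=0$ being allowed), and there are an integer $N_0\ge 1$ and a constant $M>0$ such that $$\sum_{n=m}^{2m}|c_n-c_{n+1}|\le M\max_{m\le n<m+N_0}|c_n|\qquad\text{for all } m=1,2,\dots$$ Suppose that both $\{\hat f(n)\}_{n\ge1}$ and $\{\hat f(-n)\}_{n\ge 1}$ belong to $\mathrm{GBV}$. Let $r\ge1$ be an integer and suppose that $f,f',\dots,f^{(r-1)}$ are absolutely continuous on every compact interval (so that $f^{(r)}$ exists almost everywhere and is integrable over a period). Then $$\|f-S_n(f)\|=O\left((n+1)^{-r}\,\omega\left(f^{(r)},(n+1)^{-1}\right)_L\right)\qquad(n=0,1,2,\dots)$$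 if and only if $$\hat f(n)\log|n|=O\left((|n|+1)^{-r}\,\omega\left(f^{(r)},(|n|+1)^{-1}\right)_L\right)\qquad(n\in\mathbb Z,\ n\ne0),$$ where $\omega(g,t)_L=\sup_{0\le h\le t}\|g(\cdot+h)-g\|$ is the integral modulus of continuity, and each $O$ means an inequality between absolute values with a positive constant factor that does not depend on $n$. -/

import Mathlib

open MeasureTheory

/-- The space `L_{2π}`: complex-valued functions on `ℝ` of period `2π`, integrable over a period. -/
def IsL2Pi (f : ℝ → ℂ) : Prop :=
  Function.Periodic f (2 * Real.pi) ∧ IntervalIntegrable f volume (-Real.pi) Real.pi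

/-- The norm `‖g‖ = ∫_{-π}^{π} |g(x)| dx`. -/
noncomputable def normL (g : ℝ → ℂ) : ℝ :=
  ∫ x in (-Real.pi)..Real.pi, ‖g x‖

/-- The Fourier coefficient `(1 / 2π) ∫_{-π}^{π} f(x) e^{-inx} dx`. -/
noncomputable def fhat (f : ℝ → ℂ) (n : ℤ) : ℂ :=
  fourierCoeffOn (neg_lt_self Real.pi_pos) f n

/-- The symmetric partial sum `S_n(f, x) = ∑_{k=-n}^{n} f̂(k) e^{ikx}`. -/
noncomputable def partialSum (f : ℝ → ℂ) (n : ℕ) (x : ℝ) : ℂ :=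
  ∑ k ∈ Finset.Icc (-(n : ℤ)) (n : ℤ), fhat f k * Complex.exp (Complex.I * (k : ℂ) * (x : ℂ))

/-- The sector `K(θ) = {z : |arg z| ≤ θ}`; it contains `0`, since `Complex.arg 0 = 0`. -/
def sectorK (θ : ℝ) : Set ℂ := {z | |Complex.arg z| ≤ θ}

/-- The class GBV of sequences `c 1, c 2, …` (the entry `c 0` is not used). -/
def IsGBV (c : ℕ → ℂ) : Prop :=
  (∃ θ : ℝ, 0 ≤ θ ∧ θ < Real.pi / 2 ∧ ∀ n : ℕ, 1 ≤ n → c n ∈ sectorK θ) ∧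
  ∃ N₀ : ℕ, 1 ≤ N₀ ∧ ∃ M : ℝ, 0 < M ∧ ∀ m : ℕ, 1 ≤ m →
    ∑ n ∈ Finset.Icc m (2 * m), ‖c n - c (n + 1)‖ ≤
      M * (((Finset.Ico m (m + N₀)).sup fun n => ‖c n‖₊ : NNReal) : ℝ)

/-- The integral modulus of continuity `ω(g, t)_L = sup_{0 ≤ h ≤ t} ‖g(· + h) - g‖`. -/
noncomputable def modulusL (g : ℝ → ℂ) (t : ℝ) : ℝ :=
  ⨆ h : Set.Icc (0 : ℝ) t, normL fun x => g (x + (h : ℝ)) - g x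

/-- `g` is absolutely continuous on every compact interval. -/
def IsLocallyAC (g : ℝ → ℂ) : Prop :=
  ∀ a b : ℝ, AbsolutelyContinuousOnInterval g a b

/-!
If `‖f - S_n(f)‖ ≤ ρ`, pair `f - S_n(f)` with `e^{-inx} ∑_{k ≤ 2n} sin(kx) / k`, which is bounded
uniformly in `n`. The Fourier coefficients of `f - S_n(f)` below `n` vanish, so this bounds
`∑_{k ≤ 2n} f̂(n + k) / k` by a multiple of `ρ`. The coefficients lie in a sector, so their moduli
may replace them, and the GBV condition makes `|f̂(2n)|` at most a constant times a window sum of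
these moduli; the harmonic weights then produce `|f̂(2n)| log n = O(ρ)`.

Conversely, a de la Vallée Poussin mean of `f` is as close to `f` as the best approximation, which
Jackson's theorem controls. It differs from `S_n(f)` by an average of blocks `∑_{n < k ≤ n + L}`,
`L ≤ n`, of the Fourier series. Summation by parts bounds the norm of such a block by `log n` times
the variation of its coefficients, hence, by the GBV condition, by `log n` times a sum of a fixed
number of their moduli.
-/

open scoped Real

/-! ### Absolutely continuous functions are integrals of their derivatives -/

theorem absolutelyContinuousOnInterval_comp_of_lipschitzWith {X Y : Type*} [PseudoMetricSpace X]
    [PseudoMetricSpace Y] {K : NNReal} {φ : X → Y} (hφ : LipschitzWith K φ) {f : ℝ → X} {a b : ℝ}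
    (hf : AbsolutelyContinuousOnInterval f a b) :
    AbsolutelyContinuousOnInterval (φ ∘ f) a b := by
  unfold AbsolutelyContinuousOnInterval at hf ⊢
  refine squeeze_zero (fun E => Finset.sum_nonneg fun i _ => dist_nonneg) (fun E => ?_)
    (by simpa using hf.const_mul (K : ℝ))
  rw [Finset.mul_sum]
  exact Finset.sum_le_sum fun i _ => hφ.dist_le_mul _ _

namespace IsLocallyAC

variable {f : ℝ → ℂ}

theorem ae_deriv_eq_re_add_im (hf : IsLocallyAC f) (a b : ℝ) :
    ∀ᵐ x, x ∈ Set.uIoc a b →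
      deriv f x = ((deriv (Complex.reCLM ∘ f) x : ℝ) : ℂ)
        + ((deriv (Complex.imCLM ∘ f) x : ℝ) : ℂ) * Complex.I := by
  filter_upwards [(hf a b).boundedVariationOn.ae_differentiableAt_of_mem_uIcc] with x hx hxm
  have h := (hx (Set.uIoc_subset_uIcc hxm)).hasDerivAt
  rw [(Complex.reCLM.hasFDerivAt.comp_hasDerivAt x h).deriv,
    (Complex.imCLM.hasFDerivAt.comp_hasDerivAt x h).deriv]
  exact (Complex.re_add_im _).symm

theorem intervalIntegrable_ofReal_deriv_comp (hf : IsLocallyAC f) (φ : ℂ →L[ℝ] ℝ) (a b : ℝ) :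
    IntervalIntegrable (fun x => ((deriv (φ ∘ f) x : ℝ) : ℂ)) volume a b :=
  have h := (absolutelyContinuousOnInterval_comp_of_lipschitzWith φ.lipschitz
    (hf a b)).intervalIntegrable_deriv
  ⟨h.1.ofReal, h.2.ofReal⟩

theorem integral_ofReal_deriv_comp (hf : IsLocallyAC f) (φ : ℂ →L[ℝ] ℝ) (a b : ℝ) :
    ∫ x in a..b, ((deriv (φ ∘ f) x : ℝ) : ℂ) = ((φ (f b) - φ (f a) : ℝ) : ℂ) := by
  rw [intervalIntegral.integral_ofReal, (absolutelyContinuousOnInterval_comp_of_lipschitzWith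
    φ.lipschitz (hf a b)).integral_deriv_eq_sub]
  rfl

theorem intervalIntegrable_deriv (hf : IsLocallyAC f) (a b : ℝ) :
    IntervalIntegrable (deriv f) volume a b := by
  refine ((hf.intervalIntegrable_ofReal_deriv_comp Complex.reCLM a b).add
    ((hf.intervalIntegrable_ofReal_deriv_comp Complex.imCLM a b).mul_const Complex.I)).congr_ae ?_
  rw [Filter.EventuallyEq, ae_restrict_iff' measurableSet_uIoc]
  filter_upwards [hf.ae_deriv_eq_re_add_im a b] with x hx hm using (hx hm).symm

theorem integral_deriv_eq_sub (hf : IsLocallyAC f) (a b : ℝ) :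
    ∫ x in a..b, deriv f x = f b - f a := by
  rw [intervalIntegral.integral_congr_ae (hf.ae_deriv_eq_re_add_im a b),
    intervalIntegral.integral_add (hf.intervalIntegrable_ofReal_deriv_comp Complex.reCLM a b)
      ((hf.intervalIntegrable_ofReal_deriv_comp Complex.imCLM a b).mul_const Complex.I),
    intervalIntegral.integral_mul_const, integral_ofReal_deriv_comp hf,
    integral_ofReal_deriv_comp hf]
  apply Complex.ext <;> simp

end IsLocallyAC

/-! ### The space `L_{2π}` -/

theorem neg_pi_le_pi : -π ≤ π := by linarith [Real.pi_pos]

theorem intervalIntegral_comp_add_of_periodic {E : Type*} [NormedAddCommGroup E]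
    [NormedSpace ℝ E] {g : ℝ → E} {T : ℝ} (hg : Function.Periodic g T) (a t : ℝ) :
    ∫ x in a..a + T, g (x + t) = ∫ x in a..a + T, g x := by
  rw [intervalIntegral.integral_comp_add_right, add_right_comm, hg.intervalIntegral_add_eq]

namespace IsL2Pi

variable {f g : ℝ → ℂ}

theorem intervalIntegrable (hf : IsL2Pi f) (a b : ℝ) : IntervalIntegrable f volume a b :=
  hf.1.intervalIntegrable Real.two_pi_pos.ne' (t := -π)
    (by rw [show -π + 2 * π = π by ring]; exact hf.2) a b

theorem aestronglyMeasurable (hf : IsL2Pi f) : AEStronglyMeasurable f volume :=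
  LocallyIntegrable.aestronglyMeasurable fun x =>
    ⟨Set.Ioc (x - 1) (x + 1), Ioc_mem_nhds (by linarith) (by linarith),
      (hf.intervalIntegrable _ _).1⟩

theorem of_continuous (hp : Function.Periodic f (2 * π)) (hf : Continuous f) : IsL2Pi f :=
  ⟨hp, hf.intervalIntegrable _ _⟩

theorem add (hf : IsL2Pi f) (hg : IsL2Pi g) : IsL2Pi (f + g) :=
  ⟨hf.1.add hg.1, hf.2.add hg.2⟩

theorem sub (hf : IsL2Pi f) (hg : IsL2Pi g) : IsL2Pi (f - g) :=
  ⟨hf.1.sub hg.1, hf.2.sub hg.2⟩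

theorem comp_add (hf : IsL2Pi f) (t : ℝ) : IsL2Pi fun x => f (x + t) :=
  ⟨hf.1.add_const t, by
    simpa using (hf.intervalIntegrable (-π + t) (π + t)).comp_add_right t⟩

theorem comp_sub (hf : IsL2Pi f) (t : ℝ) : IsL2Pi fun x => f (x - t) := by
  simpa only [sub_eq_add_neg] using hf.comp_add (-t)

theorem comp_neg (hf : IsL2Pi f) : IsL2Pi fun x => f (-x) :=
  ⟨fun x => by simpa only [neg_add, sub_eq_add_neg] using hf.1.sub_eq (-x),
    (IntervalIntegrable.iff_comp_neg (f := fun x => f (-x))).2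
      (by simpa using hf.2.symm)⟩

theorem mul_continuous (hf : IsL2Pi f) (hp : Function.Periodic g (2 * π)) (hg : Continuous g) :
    IsL2Pi (f * g) :=
  ⟨hf.1.mul hp, hf.2.mul_continuousOn hg.continuousOn⟩

end IsL2Pi

theorem normL_nonneg (g : ℝ → ℂ) : 0 ≤ normL g :=
  intervalIntegral.integral_nonneg neg_pi_le_pi fun _ _ => norm_nonneg _

theorem normL_add_le {f g : ℝ → ℂ} (hf : IsL2Pi f) (hg : IsL2Pi g) :
    normL (f + g) ≤ normL f + normL g := by
  rw [normL, normL, normL, ← intervalIntegral.integral_add hf.2.norm hg.2.norm]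
  exact intervalIntegral.integral_mono_on neg_pi_le_pi (hf.add hg).2.norm
    (hf.2.norm.add hg.2.norm) fun x _ => norm_add_le _ _

theorem normL_neg (g : ℝ → ℂ) : normL (-g) = normL g := by simp [normL]

theorem normL_sub_rev (f g : ℝ → ℂ) : normL (f - g) = normL (g - f) := by
  rw [← normL_neg, neg_sub]

theorem normL_sub_le {f g : ℝ → ℂ} (hf : IsL2Pi f) (hg : IsL2Pi g) :
    normL (f - g) ≤ normL f + normL g := by
  rw [normL, normL, normL, ← intervalIntegral.integral_add hf.2.norm hg.2.norm]
  exact intervalIntegral.integral_mono_on neg_pi_le_pi (hf.sub hg).2.norm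
    (hf.2.norm.add hg.2.norm) fun x _ => norm_sub_le _ _

theorem normL_comp_add {g : ℝ → ℂ} (hg : Function.Periodic g (2 * π)) (t : ℝ) :
    normL (fun x => g (x + t)) = normL g := by
  have h := intervalIntegral_comp_add_of_periodic (hg.comp norm) (-π) t
  rwa [show -π + 2 * π = π by ring] at h

theorem normL_comp_sub {g : ℝ → ℂ} (hg : Function.Periodic g (2 * π)) (t : ℝ) :
    normL (fun x => g (x - t)) = normL g := by
  simpa only [sub_eq_add_neg] using normL_comp_add hg (-t)

theorem normL_comp_neg (g : ℝ → ℂ) : normL (fun x => g (-x)) = normL g := by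
  rw [normL, intervalIntegral.integral_comp_neg fun x => ‖g x‖, neg_neg, normL]

theorem norm_integral_mul_le {f φ : ℝ → ℂ} {B : ℝ} (hf : IsL2Pi f)
    (hφ : ∀ x, |x| ≤ π → ‖φ x‖ ≤ B) : ‖∫ x in -π..π, f x * φ x‖ ≤ B * normL f := by
  rw [normL, ← intervalIntegral.integral_const_mul]
  refine intervalIntegral.norm_integral_le_of_norm_le neg_pi_le_pi
    (Filter.Eventually.of_forall fun x hx => ?_) (hf.2.norm.const_mul B)
  rw [norm_mul, mul_comm]
  exact mul_le_mul_of_nonneg_right (hφ x (abs_le.2 ⟨hx.1.le, hx.2⟩)) (norm_nonneg _)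

/-! ### The modulus of continuity -/

theorem bddAbove_range_normL_translate_sub {g : ℝ → ℂ} (hg : IsL2Pi g) (t : ℝ) :
    BddAbove (Set.range fun h : Set.Icc (0 : ℝ) t => normL fun x => g (x + (h : ℝ)) - g x) := by
  refine ⟨normL g + normL g, ?_⟩
  rintro _ ⟨h, rfl⟩
  refine (normL_sub_le (hg.comp_add h) hg).trans_eq ?_
  rw [normL_comp_add hg.1]

theorem normL_translate_sub_le_modulusL {g : ℝ → ℂ} (hg : IsL2Pi g) {h t : ℝ} (h0 : 0 ≤ h)
    (ht : h ≤ t) : normL (fun x => g (x + h) - g x) ≤ modulusL g t :=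
  le_ciSup (bddAbove_range_normL_translate_sub hg t) (⟨h, h0, ht⟩ : Set.Icc (0 : ℝ) t)

theorem modulusL_nonneg (g : ℝ → ℂ) (t : ℝ) : 0 ≤ modulusL g t :=
  Real.iSup_nonneg fun _ => normL_nonneg _

theorem modulusL_le {g : ℝ → ℂ} {t C : ℝ} (hC : 0 ≤ C)
    (h : ∀ s, 0 ≤ s → s ≤ t → normL (fun x => g (x + s) - g x) ≤ C) : modulusL g t ≤ C :=
  Real.iSup_le (fun s => h s s.2.1 s.2.2) hC

theorem modulusL_mono {g : ℝ → ℂ} (hg : IsL2Pi g) : Monotone (modulusL g) := fun _ _ hst =>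
  modulusL_le (modulusL_nonneg _ _) fun _ h0 h1 =>
    normL_translate_sub_le_modulusL hg h0 (h1.trans hst)

theorem normL_translate_nat_mul_sub_le {g : ℝ → ℂ} (hg : IsL2Pi g) (s : ℝ) (N : ℕ) :
    normL (fun x => g (x + N * s) - g x) ≤ N * normL fun x => g (x + s) - g x := by
  induction N with
  | zero => simp [normL]
  | succ N ih =>
    have hd : IsL2Pi fun x => g (x + s) - g x := (hg.comp_add s).sub hg
    have split : (fun x => g (x + (N + 1 : ℕ) * s) - g x) =
        (fun x => g (x + N * s + s) - g (x + N * s)) + fun x => g (x + N * s) - g x := by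
      funext x
      rw [Pi.add_apply, sub_add_sub_cancel, Nat.cast_succ, add_one_mul, add_assoc]
    calc normL (fun x => g (x + (N + 1 : ℕ) * s) - g x)
        ≤ normL (fun x => g (x + N * s + s) - g (x + N * s))
            + normL fun x => g (x + N * s) - g x := by
          rw [split]
          exact normL_add_le (hd.comp_add (N * s)) ((hg.comp_add _).sub hg)
      _ ≤ (N + 1 : ℕ) * normL fun x => g (x + s) - g x := by
          rw [normL_comp_add hd.1 (N * s), Nat.cast_succ, add_one_mul, add_comm]
          gcongr

theorem modulusL_nat_mul_le {g : ℝ → ℂ} (hg : IsL2Pi g) (t : ℝ) {N : ℕ} (hN : N ≠ 0) :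
    modulusL g (N * t) ≤ N * modulusL g t := by
  refine modulusL_le (mul_nonneg N.cast_nonneg (modulusL_nonneg _ _)) fun s h0 h1 => ?_
  have h_pos : (0 : ℝ) < N := by exact_mod_cast N.pos_of_ne_zero hN
  have h := normL_translate_nat_mul_sub_le hg (s / N) N
  rw [mul_div_cancel₀ _ h_pos.ne'] at h
  refine h.trans (mul_le_mul_of_nonneg_left ?_ h_pos.le)
  exact normL_translate_sub_le_modulusL hg (by positivity) (by rwa [div_le_iff₀' h_pos])

theorem normL_translate_neg_sub {g : ℝ → ℂ} (hg : Function.Periodic g (2 * π)) (t : ℝ) :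
    normL (fun x => g (x + -t) - g x) = normL fun x => g (x + t) - g x := by
  refine (normL_comp_add ((hg.add_const (-t)).sub hg) t).symm.trans ?_
  simp only [normL, Pi.sub_apply, add_neg_cancel_right, norm_sub_rev]

theorem normL_translate_sub_le {g : ℝ → ℂ} (hg : IsL2Pi g) {m : ℕ} (hm : m ≠ 0) (t : ℝ) :
    normL (fun x => g (x + t) - g x) ≤ (1 + m * |t|) * modulusL g (m : ℝ)⁻¹ := by
  have h_abs : normL (fun x => g (x + t) - g x) = normL fun x => g (x + |t|) - g x := by
    rcases abs_choice t with h | h <;> rw [h]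
    exact (normL_translate_neg_sub hg.1 t).symm
  have h_pos : (0 : ℝ) < m := by exact_mod_cast Nat.pos_of_ne_zero hm
  have h_ceil : |t| ≤ (⌊m * |t|⌋₊ + 1 : ℕ) * (m : ℝ)⁻¹ := by
    rw [← div_eq_mul_inv, le_div_iff₀' h_pos, Nat.cast_succ]
    exact (Nat.lt_floor_add_one _).le
  calc normL (fun x => g (x + t) - g x)
      ≤ modulusL g ((⌊m * |t|⌋₊ + 1 : ℕ) * (m : ℝ)⁻¹) :=
        h_abs.trans_le (normL_translate_sub_le_modulusL hg (abs_nonneg t) h_ceil)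
    _ ≤ (⌊m * |t|⌋₊ + 1 : ℕ) * modulusL g (m : ℝ)⁻¹ :=
        modulusL_nat_mul_le hg _ (Nat.succ_ne_zero _)
    _ ≤ (1 + m * |t|) * modulusL g (m : ℝ)⁻¹ := by
        refine mul_le_mul_of_nonneg_right ?_ (modulusL_nonneg _ _)
        rw [Nat.cast_succ, add_comm]
        gcongr
        exact Nat.floor_le (by positivity)

/-! ### Exponentials, Fourier coefficients and trigonometric polynomials -/

/-- The exponential `x ↦ e^{ikx}`. -/
noncomputable def expZ (k : ℤ) (x : ℝ) : ℂ := Complex.exp (Complex.I * (k : ℂ) * (x : ℂ))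

theorem continuous_expZ (k : ℤ) : Continuous (expZ k) := by
  unfold expZ
  fun_prop

theorem expZ_zero (x : ℝ) : expZ 0 x = 1 := by simp [expZ]

theorem expZ_add (k l : ℤ) (x : ℝ) : expZ (k + l) x = expZ k x * expZ l x := by
  rw [expZ, expZ, expZ, ← Complex.exp_add]
  push_cast
  ring_nf

theorem expZ_apply_add (k : ℤ) (x y : ℝ) : expZ k (x + y) = expZ k x * expZ k y := by
  rw [expZ, expZ, expZ, ← Complex.exp_add]
  push_cast
  ring_nf

theorem expZ_apply_neg (k : ℤ) (x : ℝ) : expZ k (-x) = expZ (-k) x := by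
  rw [expZ, expZ]
  push_cast
  ring_nf

theorem expZ_natCast (j : ℕ) (x : ℝ) : expZ j x = expZ 1 x ^ j := by
  rw [expZ, expZ, ← Complex.exp_nat_mul]
  push_cast
  ring_nf

theorem expZ_eq_exp_mul_I (k : ℤ) (x : ℝ) :
    expZ k x = Complex.exp (((k * x : ℝ) : ℂ) * Complex.I) := by
  rw [expZ]
  push_cast
  ring_nf

theorem norm_expZ (k : ℤ) (x : ℝ) : ‖expZ k x‖ = 1 := by
  rw [expZ_eq_exp_mul_I, Complex.norm_exp_ofReal_mul_I]

theorem conj_expZ (k : ℤ) (x : ℝ) : (starRingEnd ℂ) (expZ k x) = expZ (-k) x := by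
  simp [expZ, ← Complex.exp_conj]

theorem expZ_periodic (k : ℤ) : Function.Periodic (expZ k) (2 * π) := fun x => by
  have h_period : expZ k (2 * π) = 1 :=
    Complex.exp_eq_one_iff.2 ⟨k, by push_cast; ring⟩
  rw [expZ_apply_add, h_period, mul_one]

theorem hasDerivAt_expZ (k : ℤ) (x : ℝ) :
    HasDerivAt (expZ k) (Complex.I * k * expZ k x) x := by
  have h : HasDerivAt (fun y : ℝ => Complex.I * (k : ℂ) * (y : ℂ)) (Complex.I * k) x := by
    simpa using (Complex.ofRealCLM.hasDerivAt (x := x)).const_mul (Complex.I * (k : ℂ))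
  exact h.cexp.congr_deriv (mul_comm _ _)

theorem integral_expZ (k : ℤ) :
    ∫ x in -π..π, expZ k x = if k = 0 then 2 * (π : ℂ) else 0 := by
  split_ifs with hk
  · simp [hk, expZ_zero, two_mul]
  · have h_ends : expZ k π = expZ k (-π) := by
      simpa [two_mul] using expZ_periodic k (-π)
    have hk' : Complex.I * (k : ℂ) ≠ 0 := mul_ne_zero Complex.I_ne_zero (by exact_mod_cast hk)
    refine (integral_exp_mul_complex hk').trans ?_
    exact div_eq_zero_iff.2 (Or.inl (sub_eq_zero.2 h_ends))

theorem fhat_eq (f : ℝ → ℂ) (n : ℤ) :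
    fhat f n = (2 * (π : ℂ))⁻¹ * ∫ x in -π..π, f x * expZ (-n) x := by
  have hπ : (π : ℂ) ≠ 0 := by exact_mod_cast Real.pi_ne_zero
  rw [fhat, fourierCoeffOn_eq_integral, Complex.real_smul]
  congr 1
  · push_cast
    rw [one_div, sub_neg_eq_add, two_mul]
  · refine intervalIntegral.integral_congr fun x _ => ?_
    simp only [fourier_coe_apply, smul_eq_mul]
    rw [mul_comm, expZ]
    congr 2
    push_cast
    field_simp
    ring

theorem integral_mul_expZ_neg (f : ℝ → ℂ) (n : ℤ) :
    ∫ x in -π..π, f x * expZ (-n) x = 2 * π * fhat f n := by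
  have hπ : 2 * (π : ℂ) ≠ 0 := by exact_mod_cast Real.two_pi_pos.ne'
  rw [fhat_eq, mul_inv_cancel_left₀ hπ]

theorem fhat_sub {f g : ℝ → ℂ} (hf : IsL2Pi f) (hg : IsL2Pi g) (n : ℤ) :
    fhat (f - g) n = fhat f n - fhat g n := by
  simp only [fhat_eq, Pi.sub_apply, sub_mul]
  rw [intervalIntegral.integral_sub, mul_sub]
  · exact (hf.mul_continuous (expZ_periodic _) (continuous_expZ _)).2
  · exact (hg.mul_continuous (expZ_periodic _) (continuous_expZ _)).2

theorem fhat_comp_neg (f : ℝ → ℂ) (n : ℤ) : fhat (fun x => f (-x)) n = fhat f (-n) := by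
  have h := intervalIntegral.integral_comp_neg (a := -π) (b := π) fun x => f x * expZ n x
  rw [neg_neg] at h
  rw [fhat_eq, fhat_eq, neg_neg, ← h]
  simp only [expZ_apply_neg]

theorem norm_two_pi_inv_le : ‖(2 * (π : ℂ))⁻¹‖ ≤ 1 := by
  rw [norm_inv, norm_mul, Complex.norm_real, Real.norm_of_nonneg Real.pi_pos.le,
    Complex.norm_ofNat]
  exact inv_le_one_of_one_le₀ (by linarith [Real.pi_gt_three])

theorem norm_fhat_le {f : ℝ → ℂ} (hf : IsL2Pi f) (n : ℤ) : ‖fhat f n‖ ≤ normL f := by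
  rw [fhat_eq, norm_mul, ← one_mul (normL f)]
  refine mul_le_mul norm_two_pi_inv_le ?_ (norm_nonneg _) zero_le_one
  simpa only [one_mul] using norm_integral_mul_le hf fun x _ => (norm_expZ (-n) x).le

theorem fhat_expZ (k n : ℤ) : fhat (expZ k) n = if k = n then 1 else 0 := by
  have hπ : 2 * (π : ℂ) ≠ 0 := by exact_mod_cast Real.two_pi_pos.ne'
  simp only [fhat_eq, ← expZ_add, integral_expZ, ← sub_eq_add_neg, sub_eq_zero]
  split_ifs
  · exact inv_mul_cancel₀ hπ
  · exact mul_zero _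

theorem continuous_sum_smul_expZ {ι : Type*} (s : Finset ι) (a : ι → ℂ) (φ : ι → ℤ) :
    Continuous (∑ p ∈ s, a p • expZ (φ p)) := by
  rw [Finset.sum_fn]
  exact continuous_finsetSum _ fun p _ => (continuous_expZ (φ p)).const_smul (a p)

theorem isL2Pi_sum_smul_expZ {ι : Type*} (s : Finset ι) (a : ι → ℂ) (φ : ι → ℤ) :
    IsL2Pi (∑ p ∈ s, a p • expZ (φ p)) :=
  .of_continuous (fun x => by simp [expZ_periodic _ x])
    (continuous_sum_smul_expZ s a φ)

theorem fhat_sum_smul_expZ (s : Finset ℤ) (a : ℤ → ℂ) (n : ℤ) :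
    fhat (∑ k ∈ s, a k • expZ k) n = if n ∈ s then a n else 0 := by
  have h_term : ∀ k, (2 * (π : ℂ))⁻¹ * ∫ x in -π..π, a k * (expZ k x * expZ (-n) x) =
      if k = n then a k else 0 := fun k => by
    rw [intervalIntegral.integral_const_mul, mul_left_comm, ← fhat_eq, fhat_expZ, mul_ite,
      mul_one, mul_zero]
  simp only [fhat_eq, Finset.sum_apply, Pi.smul_apply, smul_eq_mul, Finset.sum_mul, mul_assoc]
  rw [intervalIntegral.integral_finsetSum, Finset.mul_sum]
  · simp only [h_term, Finset.sum_ite_eq']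
  · exact fun k _ => (continuous_const.mul
      ((continuous_expZ k).mul (continuous_expZ (-n)))).intervalIntegrable _ _

theorem partialSum_eq_sum_smul (f : ℝ → ℂ) (n : ℕ) :
    partialSum f n = ∑ k ∈ Finset.Icc (-(n : ℤ)) n, fhat f k • expZ k := by
  funext x
  simp [partialSum, expZ]

theorem isL2Pi_partialSum (f : ℝ → ℂ) (n : ℕ) : IsL2Pi (partialSum f n) := by
  rw [partialSum_eq_sum_smul]
  exact isL2Pi_sum_smul_expZ _ _ _

/-- The space of trigonometric polynomials of degree at most `n`. -/
noncomputable def trigPoly (n : ℕ) : Submodule ℂ (ℝ → ℂ) :=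
  Submodule.span ℂ (expZ '' ↑(Finset.Icc (-(n : ℤ)) n))

theorem expZ_mem_trigPoly {n : ℕ} {k : ℤ} (hk : |k| ≤ n) : expZ k ∈ trigPoly n :=
  Submodule.subset_span ⟨k, Finset.mem_coe.2 (Finset.mem_Icc.2 (abs_le.1 hk)), rfl⟩

theorem trigPoly_mono : Monotone trigPoly := fun m n h =>
  Submodule.span_mono <| Set.image_mono <| Finset.coe_subset.2 <|
    Finset.Icc_subset_Icc (by lia) (by lia)

theorem mul_mem_trigPoly {m n : ℕ} {S T : ℝ → ℂ} (hS : S ∈ trigPoly m) (hT : T ∈ trigPoly n) :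
    S * T ∈ trigPoly (m + n) := by
  have h := Submodule.mul_mem_mul hS hT
  rw [trigPoly, trigPoly, Submodule.span_mul_span] at h
  refine Submodule.span_mono ?_ h
  rintro _ ⟨_, ⟨k, hk, rfl⟩, _, ⟨l, hl, rfl⟩, rfl⟩
  refine ⟨k + l, ?_, funext fun x => expZ_add k l x⟩
  simp only [Finset.coe_Icc, Set.mem_Icc] at hk hl ⊢
  lia

theorem mem_trigPoly_iff {n : ℕ} {T : ℝ → ℂ} :
    T ∈ trigPoly n ↔ ∃ a : ℤ → ℂ, ∑ k ∈ Finset.Icc (-(n : ℤ)) n, a k • expZ k = T :=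
  Submodule.mem_span_image_finset_iff_exists_fun' ℂ

theorem continuous_of_mem_trigPoly {n : ℕ} {T : ℝ → ℂ} (hT : T ∈ trigPoly n) : Continuous T := by
  obtain ⟨a, rfl⟩ := mem_trigPoly_iff.1 hT
  exact continuous_sum_smul_expZ _ _ _

theorem isL2Pi_of_mem_trigPoly {n : ℕ} {T : ℝ → ℂ} (hT : T ∈ trigPoly n) : IsL2Pi T := by
  obtain ⟨a, rfl⟩ := mem_trigPoly_iff.1 hT
  exact isL2Pi_sum_smul_expZ _ _ _

theorem sum_fhat_smul_expZ_of_mem_trigPoly {n : ℕ} {T : ℝ → ℂ} (hT : T ∈ trigPoly n)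
    {s : Finset ℤ} (hs : Finset.Icc (-(n : ℤ)) n ⊆ s) : ∑ k ∈ s, fhat T k • expZ k = T := by
  obtain ⟨a, rfl⟩ := mem_trigPoly_iff.1 hT
  simp only [fhat_sum_smul_expZ, ite_smul, zero_smul, ← Finset.sum_filter,
    Finset.filter_mem_eq_inter, Finset.inter_eq_right.2 hs]

theorem exists_antideriv_of_mem_trigPoly {n : ℕ} {T : ℝ → ℂ} (hT : T ∈ trigPoly n) :
    ∃ Q ∈ trigPoly n, ∃ c : ℂ, ∀ x, HasDerivAt Q (T x - c) x := by
  obtain ⟨a, rfl⟩ := mem_trigPoly_iff.1 hT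
  -- For `k = 0` the junk value `0⁻¹ = 0` removes the constant term from `Q`.
  refine ⟨_, mem_trigPoly_iff.2 ⟨fun k => a k * (Complex.I * k)⁻¹, rfl⟩, a 0, fun x => ?_⟩
  have h_term : ∀ k : ℤ, (a k * (Complex.I * k)⁻¹) • (Complex.I * k * expZ k x) =
      a k * expZ k x - if k = 0 then a 0 else 0 := fun k => by
    rcases eq_or_ne k 0 with rfl | hk
    · simp [expZ_zero]
    · have hk' : (k : ℂ) ≠ 0 := by exact_mod_cast hk
      rw [if_neg hk, smul_eq_mul]
      field_simp
      ring
  refine (HasDerivAt.sum fun k _ => (hasDerivAt_expZ k x).const_smul _).congr_deriv ?_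
  simp only [h_term, Finset.sum_sub_distrib]
  simp

/-! ### Minkowski's inequality and convolution over a period -/

theorem integral_norm_integral_le {α β E : Type*} [MeasurableSpace α] [MeasurableSpace β]
    [NormedAddCommGroup E] [NormedSpace ℝ E] {μ : Measure α} {ν : Measure β} [SFinite μ] [SFinite ν]
    {F : α → β → E} (hF : Integrable (Function.uncurry F) (μ.prod ν)) :
    ∫ x, ‖∫ t, F x t ∂ν‖ ∂μ ≤ ∫ t, ∫ x, ‖F x t‖ ∂μ ∂ν :=
  calc ∫ x, ‖∫ t, F x t ∂ν‖ ∂μ ≤ ∫ x, ∫ t, ‖F x t‖ ∂ν ∂μ :=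
        integral_mono_of_nonneg (.of_forall fun _ => norm_nonneg _) hF.norm.integral_prod_left
          (.of_forall fun _ => norm_integral_le_integral_norm _)
    _ = ∫ t, ∫ x, ‖F x t‖ ∂μ ∂ν := integral_integral_swap hF.norm

theorem normL_integral_le {a b : ℝ} (hab : a ≤ b) {F : ℝ → ℝ → ℂ}
    (hF : Integrable (Function.uncurry F)
      ((volume.restrict (Set.Ioc (-π) π)).prod (volume.restrict (Set.Ioc a b)))) :
    normL (fun x => ∫ t in a..b, F x t) ≤ ∫ t in a..b, normL fun x => F x t := by
  simpa only [normL, intervalIntegral.integral_of_le hab, intervalIntegral.integral_of_le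
    neg_pi_le_pi] using integral_norm_integral_le hF

theorem normL_mul_const (g : ℝ → ℂ) (c : ℂ) : normL (fun x => g x * c) = normL g * ‖c‖ := by
  simp only [normL, norm_mul, intervalIntegral.integral_mul_const]

theorem IsL2Pi.integrable_comp_sub_mul {g k : ℝ → ℂ} (hg : IsL2Pi g) {S : Set ℝ}
    (hk : IntegrableOn k S) :
    Integrable (Function.uncurry fun x t => g (x - t) * k t)
      ((volume.restrict (Set.Ioc (-π) π)).prod (volume.restrict S)) := by
  have h_meas : AEStronglyMeasurable (fun p : ℝ × ℝ => g (p.1 - p.2))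
      ((volume.restrict (Set.Ioc (-π) π)).prod (volume.restrict S)) := by
    rw [Measure.prod_restrict]
    exact (hg.aestronglyMeasurable.comp_quasiMeasurePreserving
      (quasiMeasurePreserving_sub volume volume)).restrict
  have h_norm : ∀ t, ∫ x in Set.Ioc (-π) π, ‖g (x - t) * k t‖ = normL g * ‖k t‖ := fun t => by
    rw [← normL_comp_sub hg.1 t, ← normL_mul_const, normL,
      intervalIntegral.integral_of_le neg_pi_le_pi]
  refine (integrable_prod_iff' (h_meas.mul hk.aestronglyMeasurable.comp_snd)).2
    ⟨.of_forall fun t => (hg.comp_sub t).2.1.mul_const (k t), ?_⟩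
  exact (hk.norm.const_mul (normL g)).congr (.of_forall fun t => (h_norm t).symm)

/-- The convolution of `g` and `K` over a period. -/
noncomputable def perConv (g K : ℝ → ℂ) (x : ℝ) : ℂ :=
  ∫ t in -π..π, g (x - t) * K t

theorem normL_perConv_le {g K : ℝ → ℂ} (hg : IsL2Pi g)
    (hK : IntervalIntegrable K volume (-π) π) :
    normL (perConv g K) ≤ normL g * normL K := by
  refine (normL_integral_le neg_pi_le_pi (hg.integrable_comp_sub_mul hK.1)).trans_eq ?_
  simp only [normL_mul_const, normL_comp_sub hg.1, intervalIntegral.integral_const_mul]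
  rfl

theorem IsL2Pi.intervalIntegrable_comp_sub_mul {g K : ℝ → ℂ} (hg : IsL2Pi g) (hK : Continuous K)
    (x a b : ℝ) : IntervalIntegrable (fun t => g (x - t) * K t) volume a b := by
  have h := ((hg.intervalIntegrable (x - a) (x - b)).comp_sub_left x).mul_continuousOn
    hK.continuousOn
  simpa only [sub_sub_cancel] using h

theorem sub_perConv_eq_integral {g K : ℝ → ℂ} (hg : IsL2Pi g) (hK : Continuous K)
    (hK1 : ∫ t in -π..π, K t = 1) :
    g - perConv g K = fun x => ∫ t in -π..π, (g x - g (x - t)) * K t := by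
  funext x
  have h_const : ∫ t in -π..π, g x * K t = g x := by
    rw [intervalIntegral.integral_const_mul, hK1, mul_one]
  simp only [sub_mul]
  rw [intervalIntegral.integral_sub, h_const]
  · rfl
  · exact (continuous_const.mul hK).intervalIntegrable _ _
  · exact hg.intervalIntegrable_comp_sub_mul hK x _ _

theorem normL_sub_perConv_le {g K : ℝ → ℂ} (hg : IsL2Pi g) (hK : Continuous K)
    (hK1 : ∫ t in -π..π, K t = 1) {B : ℝ → ℝ} (hB : Continuous B)
    (h : ∀ t, normL (fun x => g (x - t) - g x) ≤ B t) :
    normL (g - perConv g K) ≤ ∫ t in -π..π, B t * ‖K t‖ := by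
  have h_int : Integrable (Function.uncurry fun x t => (g x - g (x - t)) * K t)
      ((volume.restrict (Set.Ioc (-π) π)).prod (volume.restrict (Set.Ioc (-π) π))) := by
    have hKi := (hK.intervalIntegrable (μ := volume) (-π) π).1
    exact ((hg.2.1.mul_prod hKi).sub (hg.integrable_comp_sub_mul hKi)).congr
      (.of_forall fun _ => (sub_mul _ _ _).symm)
  rw [sub_perConv_eq_integral hg hK hK1]
  refine (normL_integral_le neg_pi_le_pi h_int).trans ?_
  simp only [normL_mul_const, intervalIntegral.integral_of_le neg_pi_le_pi]
  refine integral_mono_of_nonneg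
    (.of_forall fun t => mul_nonneg (normL_nonneg _) (norm_nonneg _))
    ((hB.mul hK.norm).intervalIntegrable _ _).1
    (.of_forall fun t => mul_le_mul_of_nonneg_right ?_ (norm_nonneg _))
  exact (normL_sub_rev g fun x => g (x - t)).trans_le (h t)

theorem perConv_expZ {g : ℝ → ℂ} (hg : Function.Periodic g (2 * π)) (k : ℤ) (x : ℝ) :
    perConv g (expZ k) x = 2 * π * fhat g k * expZ k x := by
  have h_shift : perConv g (expZ k) x = ∫ u in -π..π, g u * expZ k (x - u) := by
    have h_per : Function.Periodic (fun u => g u * expZ k (x - u)) (2 * π) := fun u => by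
      simp only [hg u, sub_add_eq_sub_sub, (expZ_periodic k).sub_eq]
    have h := intervalIntegral.integral_comp_sub_left (a := -π) (b := π)
      (fun u => g u * expZ k (x - u)) x
    simp only [sub_sub_cancel] at h
    rw [perConv, h]
    have h' := h_per.intervalIntegral_add_eq (x - π) (-π)
    convert h' using 2 <;> ring
  have h_factor : ∀ u, g u * expZ k (x - u) = g u * expZ (-k) u * expZ k x := fun u => by
    rw [sub_eq_add_neg, expZ_apply_add, expZ_apply_neg]
    ring
  simp only [h_shift, h_factor, intervalIntegral.integral_mul_const, integral_mul_expZ_neg]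

theorem perConv_sum_smul_expZ {g : ℝ → ℂ} (hg : IsL2Pi g) {ι : Type*} (s : Finset ι) (a : ι → ℂ)
    (φ : ι → ℤ) : perConv g (∑ p ∈ s, a p • expZ (φ p)) =
      ∑ p ∈ s, (2 * π * (a p * fhat g (φ p))) • expZ (φ p) := by
  funext x
  have h_term : ∀ p, ∫ t in -π..π, g (x - t) * (a p * expZ (φ p) t) =
      2 * π * (a p * fhat g (φ p)) * expZ (φ p) x := fun p => by
    simp only [mul_left_comm _ (a p), intervalIntegral.integral_const_mul]
    refine (congrArg (a p * ·) (perConv_expZ hg.1 (φ p) x)).trans ?_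
    ring
  simp only [perConv, Finset.sum_apply, Pi.smul_apply, smul_eq_mul, Finset.mul_sum]
  rw [intervalIntegral.integral_finsetSum]
  · simp only [h_term]
  · exact fun p _ => hg.intervalIntegrable_comp_sub_mul
      (continuous_const.mul (continuous_expZ (φ p))) x _ _

theorem perConv_mem_trigPoly {g K : ℝ → ℂ} {n : ℕ} (hg : IsL2Pi g) (hK : K ∈ trigPoly n) :
    perConv g K ∈ trigPoly n := by
  obtain ⟨a, rfl⟩ := mem_trigPoly_iff.1 hK
  rw [perConv_sum_smul_expZ hg]
  exact mem_trigPoly_iff.2 ⟨_, rfl⟩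

theorem modulusL_le_mul_normL_of_integral_eq_sub {f f' : ℝ → ℂ} (hf' : IsL2Pi f')
    (h : ∀ a b, ∫ x in a..b, f' x = f b - f a) {t : ℝ} (ht : 0 ≤ t) :
    modulusL f t ≤ t * normL f' := by
  refine modulusL_le (mul_nonneg ht (normL_nonneg _)) fun s hs hst => ?_
  have h_eq : (fun x => f (x + s) - f x) =
      fun x => ∫ u in (0 : ℝ)..s, f' (x + s - u) * 1 := by
    funext x
    simp only [mul_one, intervalIntegral.integral_comp_sub_left f', h, add_sub_cancel_right,
      sub_zero]
  have h_int : Integrable (Function.uncurry fun x u => f' (x + s - u) * 1)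
      ((volume.restrict (Set.Ioc (-π) π)).prod (volume.restrict (Set.Ioc 0 s))) := by
    simpa only [add_sub_right_comm] using (hf'.comp_add s).integrable_comp_sub_mul
      (integrableOn_const (C := (1 : ℂ)) measure_Ioc_lt_top.ne)
  have h_norm : ∀ u, normL (fun x => f' (x + s - u) * 1) = normL f' := fun u => by
    simp only [mul_one, add_sub_assoc, normL_comp_add hf'.1]
  rw [h_eq]
  refine (normL_integral_le hs h_int).trans ?_
  simp only [h_norm, intervalIntegral.integral_const, sub_zero, smul_eq_mul]
  gcongr
  exact normL_nonneg _

/-! ### Jackson's theorem -/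

/-- The one-sided Dirichlet kernel `∑_{j < m} e^{ijx}`. -/
noncomputable def geomExp (m : ℕ) (x : ℝ) : ℂ := ∑ j ∈ Finset.range m, expZ j x

theorem continuous_geomExp (m : ℕ) : Continuous (geomExp m) :=
  continuous_finsetSum _ fun j _ => continuous_expZ j

theorem norm_geomExp_le (m : ℕ) (x : ℝ) : ‖geomExp m x‖ ≤ m := by
  refine (norm_sum_le _ _).trans_eq ?_
  simp [norm_expZ]

theorem two_div_pi_mul_abs_le_norm_expZ_one_sub_one {x : ℝ} (hx : |x| ≤ π) :
    2 / π * |x| ≤ ‖expZ 1 x - 1‖ := by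
  have h_exp : expZ 1 x = Complex.exp (Complex.I * x) := by simp [expZ]
  have h_half : |x / 2| = |x| / 2 := by rw [abs_div, abs_two]
  have h_sin := Real.mul_abs_le_abs_sin (x := x / 2) (by linarith)
  rw [h_half] at h_sin
  rw [h_exp, Complex.norm_exp_I_mul_ofReal_sub_one, norm_mul, Real.norm_eq_abs, Real.norm_eq_abs,
    abs_two]
  linarith

theorem norm_geomExp_mul_abs_le (m : ℕ) {x : ℝ} (hx : |x| ≤ π) :
    ‖geomExp m x‖ * |x| ≤ π := by
  have h_geom : geomExp m x * (expZ 1 x - 1) = expZ 1 x ^ m - 1 := by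
    simp only [geomExp, expZ_natCast]
    exact geom_sum_mul _ _
  have h_num : ‖expZ 1 x ^ m - 1‖ ≤ 2 := by
    refine (norm_sub_le _ _).trans_eq ?_
    rw [norm_pow, norm_expZ, one_pow, norm_one, one_add_one_eq_two]
  have h_two : 2 / π * (‖geomExp m x‖ * |x|) ≤ 2 := by
    calc 2 / π * (‖geomExp m x‖ * |x|) = ‖geomExp m x‖ * (2 / π * |x|) := by ring
      _ ≤ ‖geomExp m x‖ * ‖expZ 1 x - 1‖ := by
        gcongr
        exact two_div_pi_mul_abs_le_norm_expZ_one_sub_one hx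
      _ ≤ 2 := by rwa [← norm_mul, h_geom]
  rw [div_mul_eq_mul_div, div_le_iff₀ Real.pi_pos] at h_two
  linarith

theorem norm_geomExp_le_div {m L : ℕ} (hm : m ≤ L) (hL : L ≠ 0) {x : ℝ} (hx : |x| ≤ π) :
    ‖geomExp m x‖ ≤ (1 + π) * (|x| + (L : ℝ)⁻¹)⁻¹ := by
  have hL' : (0 : ℝ) < L := by exact_mod_cast Nat.pos_of_ne_zero hL
  have h_size : ‖geomExp m x‖ * (L : ℝ)⁻¹ ≤ 1 := by
    rw [← div_eq_mul_inv, div_le_one hL']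
    exact (norm_geomExp_le m x).trans (by exact_mod_cast hm)
  rw [← div_eq_mul_inv, le_div_iff₀ (by positivity), mul_add]
  linarith [norm_geomExp_mul_abs_le m hx]

theorem half_le_norm_geomExp {m : ℕ} {x : ℝ} (hx0 : 0 ≤ x) (hx : m * x ≤ 1) :
    (m : ℝ) / 2 ≤ ‖geomExp m x‖ := by
  have h_re : ∀ j ∈ Finset.range m, (1 / 2 : ℝ) ≤ (expZ j x).re := fun j hj => by
    have h_le : (j : ℝ) * x ≤ 1 := by
      refine le_trans ?_ hx
      gcongr
      exact (Finset.mem_range.1 hj).le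
    have h_cos := Real.one_sub_sq_div_two_le_cos (x := (j : ℝ) * x)
    rw [expZ_eq_exp_mul_I, Complex.exp_ofReal_mul_I_re, Int.cast_natCast]
    have : 0 ≤ (j : ℝ) * x := by positivity
    nlinarith
  calc (m : ℝ) / 2 = ∑ j ∈ Finset.range m, (1 / 2 : ℝ) := by simp [div_eq_mul_inv]
    _ ≤ ∑ j ∈ Finset.range m, (expZ j x).re := Finset.sum_le_sum h_re
    _ ≤ ‖geomExp m x‖ := by
      rw [← Complex.re_sum]
      exact Complex.re_le_norm _

theorem integral_norm_sum_expZ_sq (s : Finset ℤ) :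
    ∫ x in -π..π, ‖∑ k ∈ s, expZ k x‖ ^ 2 = 2 * π * s.card := by
  have h_sq : ∀ x, ((‖∑ k ∈ s, expZ k x‖ ^ 2 : ℝ) : ℂ) = ∑ k ∈ s, ∑ l ∈ s, expZ (k - l) x := by
    intro x
    push_cast
    rw [← Complex.mul_conj', map_sum, Finset.sum_mul_sum]
    simp only [conj_expZ, ← expZ_add, sub_eq_add_neg]
  have h_row : ∀ k ∈ s, ∫ x in -π..π, ∑ l ∈ s, expZ (k - l) x = 2 * (π : ℂ) := by
    intro k hk
    rw [intervalIntegral.integral_finsetSum fun l _ => (continuous_expZ _).intervalIntegrable _ _]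
    simp only [integral_expZ, sub_eq_zero, Finset.sum_ite_eq, if_pos hk]
  have h_total : ∫ x in -π..π, ((‖∑ k ∈ s, expZ k x‖ ^ 2 : ℝ) : ℂ) = 2 * π * s.card := by
    simp only [h_sq]
    rw [intervalIntegral.integral_finsetSum fun k _ =>
      (continuous_finsetSum _ fun l _ => continuous_expZ _).intervalIntegrable _ _,
      Finset.sum_congr rfl h_row, Finset.sum_const, nsmul_eq_mul, mul_comm]
  rw [intervalIntegral.integral_ofReal] at h_total
  exact_mod_cast h_total

theorem integral_norm_geomExp_sq (m : ℕ) :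
    ∫ x in -π..π, ‖geomExp m x‖ ^ 2 = 2 * π * m := by
  have h := integral_norm_sum_expZ_sq ((Finset.range m).map Nat.castEmbedding)
  simpa [geomExp] using h

theorem cube_div_le_integral_norm_geomExp_pow_four {m : ℕ} (hm : m ≠ 0) :
    (m : ℝ) ^ 3 / 16 ≤ ∫ x in -π..π, ‖geomExp m x‖ ^ 4 := by
  have h_one_le : (1 : ℝ) ≤ m := by exact_mod_cast Nat.one_le_iff_ne_zero.2 hm
  have h_cont : Continuous fun x => ‖geomExp m x‖ ^ 4 := (continuous_geomExp m).norm.pow 4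
  have h_inv : (m : ℝ)⁻¹ ≤ 1 := inv_le_one_of_one_le₀ h_one_le
  have hπ := Real.pi_gt_three
  calc (m : ℝ) ^ 3 / 16 = ∫ x in (0 : ℝ)..(m : ℝ)⁻¹, ((m : ℝ) / 2) ^ 4 := by
        rw [intervalIntegral.integral_const, sub_zero, smul_eq_mul]
        field_simp
        norm_num
    _ ≤ ∫ x in (0 : ℝ)..(m : ℝ)⁻¹, ‖geomExp m x‖ ^ 4 := by
        refine intervalIntegral.integral_mono_on (by positivity) intervalIntegrable_const
          (h_cont.intervalIntegrable _ _) fun x hx => ?_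
        gcongr
        exact half_le_norm_geomExp hx.1 (mul_le_of_le_inv_mul₀ zero_le_one (by positivity)
          (by simpa using hx.2))
    _ ≤ ∫ x in -π..π, ‖geomExp m x‖ ^ 4 :=
        intervalIntegral.integral_mono_interval (by linarith) (by positivity) (by linarith)
          (.of_forall fun x => by positivity) (h_cont.intervalIntegrable _ _)

theorem integral_abs_mul_norm_geomExp_pow_four_le (m : ℕ) :
    ∫ x in -π..π, |x| * ‖geomExp m x‖ ^ 4 ≤ 2 * π ^ 2 * (m : ℝ) ^ 2 := by
  have h_cont := (continuous_geomExp m).norm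
  calc ∫ x in -π..π, |x| * ‖geomExp m x‖ ^ 4
      ≤ ∫ x in -π..π, π * m * ‖geomExp m x‖ ^ 2 := by
        refine intervalIntegral.integral_mono_on neg_pi_le_pi
          ((continuous_abs.mul (h_cont.pow 4)).intervalIntegrable _ _)
          ((continuous_const.mul (h_cont.pow 2)).intervalIntegrable _ _) fun x hx => ?_
        calc |x| * ‖geomExp m x‖ ^ 4
            = ‖geomExp m x‖ * |x| * ‖geomExp m x‖ * ‖geomExp m x‖ ^ 2 := by ring
          _ ≤ π * m * ‖geomExp m x‖ ^ 2 := by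
            gcongr
            · exact norm_geomExp_mul_abs_le m (abs_le.2 hx)
            · exact norm_geomExp_le m x
    _ = 2 * π ^ 2 * (m : ℝ) ^ 2 := by
        rw [intervalIntegral.integral_const_mul, integral_norm_geomExp_sq]
        ring

theorem geomExp_mem_trigPoly (m : ℕ) : geomExp m ∈ trigPoly (m - 1) := by
  rw [show geomExp m = ∑ j ∈ Finset.range m, expZ j from (Finset.sum_fn _ _).symm]
  refine Submodule.sum_mem _ fun j hj => expZ_mem_trigPoly ?_
  rw [Finset.mem_range] at hj
  rw [Nat.abs_cast]
  lia

theorem conj_geomExp_mem_trigPoly (m : ℕ) :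
    (fun x => (starRingEnd ℂ) (geomExp m x)) ∈ trigPoly (m - 1) := by
  have h_eq : (fun x => (starRingEnd ℂ) (geomExp m x)) = ∑ j ∈ Finset.range m, expZ (-j) := by
    funext x
    simp only [geomExp, map_sum, conj_expZ, Finset.sum_apply]
  rw [h_eq]
  refine Submodule.sum_mem _ fun j hj => expZ_mem_trigPoly ?_
  rw [Finset.mem_range] at hj
  rw [abs_neg, Nat.abs_cast]
  lia

theorem norm_geomExp_pow_four_mem_trigPoly {m n : ℕ} (h : 4 * (m - 1) ≤ n) :
    (fun x => ((‖geomExp m x‖ ^ 4 : ℝ) : ℂ)) ∈ trigPoly n := by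
  have h_sq := mul_mem_trigPoly (geomExp_mem_trigPoly m) (conj_geomExp_mem_trigPoly m)
  refine trigPoly_mono (by lia : m - 1 + (m - 1) + (m - 1 + (m - 1)) ≤ n) ?_
  convert mul_mem_trigPoly h_sq h_sq using 1
  funext x
  simp only [Pi.mul_apply, Complex.mul_conj']
  push_cast
  ring

/-- The Jackson kernel `‖∑_{j < m} e^{ijt}‖⁴`, normalized to have integral `1` over a period and
valued in `ℂ` so that functions can be convolved with it. -/
noncomputable def jacksonKernel (m : ℕ) (t : ℝ) : ℂ :=
  (((∫ u in -π..π, ‖geomExp m u‖ ^ 4)⁻¹ * ‖geomExp m t‖ ^ 4 : ℝ) : ℂ)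

theorem jacksonKernel_mem_trigPoly {m n : ℕ} (h : 4 * (m - 1) ≤ n) :
    jacksonKernel m ∈ trigPoly n := by
  have h_smul := Submodule.smul_mem _ (((∫ u in -π..π, ‖geomExp m u‖ ^ 4)⁻¹ : ℝ) : ℂ)
    (norm_geomExp_pow_four_mem_trigPoly h)
  convert h_smul using 1
  funext t
  exact Complex.ofReal_mul _ _

theorem continuous_jacksonKernel (m : ℕ) : Continuous (jacksonKernel m) :=
  continuous_of_mem_trigPoly (jacksonKernel_mem_trigPoly le_rfl)

theorem norm_jacksonKernel (m : ℕ) (t : ℝ) :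
    ‖jacksonKernel m t‖ = (∫ u in -π..π, ‖geomExp m u‖ ^ 4)⁻¹ * ‖geomExp m t‖ ^ 4 := by
  rw [jacksonKernel, Complex.norm_real, Real.norm_of_nonneg]
  exact mul_nonneg (inv_nonneg.2 (intervalIntegral.integral_nonneg neg_pi_le_pi
    fun u _ => by positivity)) (by positivity)

theorem integral_norm_geomExp_pow_four_pos {m : ℕ} (hm : m ≠ 0) :
    0 < ∫ x in -π..π, ‖geomExp m x‖ ^ 4 :=
  lt_of_lt_of_le (by positivity) (cube_div_le_integral_norm_geomExp_pow_four hm)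

theorem integral_norm_jacksonKernel {m : ℕ} (hm : m ≠ 0) :
    ∫ t in -π..π, ‖jacksonKernel m t‖ = 1 := by
  simp only [norm_jacksonKernel, intervalIntegral.integral_const_mul]
  exact inv_mul_cancel₀ (integral_norm_geomExp_pow_four_pos hm).ne'

theorem integral_jacksonKernel {m : ℕ} (hm : m ≠ 0) :
    ∫ t in -π..π, jacksonKernel m t = 1 := by
  have h := integral_norm_jacksonKernel hm
  simp only [norm_jacksonKernel] at h
  simp only [jacksonKernel, intervalIntegral.integral_ofReal, h, Complex.ofReal_one]

theorem integral_abs_mul_norm_jacksonKernel_le {m : ℕ} (hm : m ≠ 0) :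
    ∫ t in -π..π, |t| * ‖jacksonKernel m t‖ ≤ 32 * π ^ 2 / m := by
  have : (0 : ℝ) < m := by exact_mod_cast Nat.pos_of_ne_zero hm
  simp only [norm_jacksonKernel, mul_left_comm |_|, intervalIntegral.integral_const_mul]
  rw [inv_mul_le_iff₀ (integral_norm_geomExp_pow_four_pos hm)]
  calc ∫ t in -π..π, |t| * ‖geomExp m t‖ ^ 4 ≤ 2 * π ^ 2 * (m : ℝ) ^ 2 :=
        integral_abs_mul_norm_geomExp_pow_four_le m
    _ = (m : ℝ) ^ 3 / 16 * (32 * π ^ 2 / m) := by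
        field_simp
        norm_num
    _ ≤ (∫ t in -π..π, ‖geomExp m t‖ ^ 4) * (32 * π ^ 2 / m) := by
        gcongr
        exact cube_div_le_integral_norm_geomExp_pow_four hm

theorem normL_sub_perConv_jacksonKernel_le {g : ℝ → ℂ} (hg : IsL2Pi g) {m : ℕ} (hm : m ≠ 0) :
    normL (g - perConv g (jacksonKernel m)) ≤ (1 + 32 * π ^ 2) * modulusL g (m : ℝ)⁻¹ := by
  have h_pos : (0 : ℝ) < m := by exact_mod_cast Nat.pos_of_ne_zero hm
  have h_cont := continuous_jacksonKernel m
  have h_cont_abs : Continuous fun t : ℝ => m * (|t| * ‖jacksonKernel m t‖) := by fun_prop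
  have h_translate : ∀ t, normL (fun x => g (x - t) - g x) ≤
      (1 + m * |t|) * modulusL g (m : ℝ)⁻¹ := fun t => by
    simpa only [sub_eq_add_neg, abs_neg] using normL_translate_sub_le hg hm (-t)
  have h_split : ∀ t, (1 + m * |t|) * modulusL g (m : ℝ)⁻¹ * ‖jacksonKernel m t‖ =
      modulusL g (m : ℝ)⁻¹ * (‖jacksonKernel m t‖ + m * (|t| * ‖jacksonKernel m t‖)) :=
    fun t => by ring
  have h_moment : m * ∫ t in -π..π, |t| * ‖jacksonKernel m t‖ ≤ 32 * π ^ 2 := by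
    rw [← le_div_iff₀' h_pos]
    exact integral_abs_mul_norm_jacksonKernel_le hm
  calc normL (g - perConv g (jacksonKernel m))
      ≤ ∫ t in -π..π, (1 + m * |t|) * modulusL g (m : ℝ)⁻¹ * ‖jacksonKernel m t‖ :=
        normL_sub_perConv_le hg h_cont (integral_jacksonKernel hm) (by fun_prop) h_translate
    _ = modulusL g (m : ℝ)⁻¹ * (1 + m * ∫ t in -π..π, |t| * ‖jacksonKernel m t‖) := by
        simp only [h_split, intervalIntegral.integral_const_mul]
        rw [intervalIntegral.integral_add (h_cont.norm.intervalIntegrable _ _)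
          (h_cont_abs.intervalIntegrable _ _), integral_norm_jacksonKernel hm,
          intervalIntegral.integral_const_mul]
    _ ≤ modulusL g (m : ℝ)⁻¹ * (1 + 32 * π ^ 2) := by
        gcongr
        exact modulusL_nonneg _ _
    _ = (1 + 32 * π ^ 2) * modulusL g (m : ℝ)⁻¹ := mul_comm _ _

theorem exists_mem_trigPoly_normL_sub_le_modulusL {g : ℝ → ℂ} (hg : IsL2Pi g) (n : ℕ) :
    ∃ T ∈ trigPoly n,
      normL (g - T) ≤ 4 * (1 + 32 * π ^ 2) * modulusL g ((n : ℝ) + 1)⁻¹ := by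
  obtain ⟨m, hm, hmn, hnm⟩ : ∃ m : ℕ, m ≠ 0 ∧ 4 * (m - 1) ≤ n ∧ n + 1 ≤ 4 * m :=
    ⟨n / 4 + 1, by lia, by lia, by lia⟩
  have h_pos : (0 : ℝ) < m := by exact_mod_cast Nat.pos_of_ne_zero hm
  have h_inv : (m : ℝ)⁻¹ ≤ (4 : ℕ) * ((n : ℝ) + 1)⁻¹ := by
    rw [← div_eq_mul_inv, inv_le_comm₀ h_pos (by positivity), inv_div, div_le_iff₀' (by norm_num)]
    exact_mod_cast hnm
  have h_mod : modulusL g (m : ℝ)⁻¹ ≤ 4 * modulusL g ((n : ℝ) + 1)⁻¹ :=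
    (modulusL_mono hg h_inv).trans (modulusL_nat_mul_le hg _ four_ne_zero)
  refine ⟨_, perConv_mem_trigPoly hg (jacksonKernel_mem_trigPoly hmn), ?_⟩
  calc normL (g - perConv g (jacksonKernel m))
      ≤ (1 + 32 * π ^ 2) * modulusL g (m : ℝ)⁻¹ := normL_sub_perConv_jacksonKernel_le hg hm
    _ ≤ (1 + 32 * π ^ 2) * (4 * modulusL g ((n : ℝ) + 1)⁻¹) := by gcongr
    _ = _ := by ring

theorem periodic_deriv {f : ℝ → ℂ} {c : ℝ} (hf : Function.Periodic f c) :
    Function.Periodic (deriv f) c := fun x => by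
  rw [← deriv_comp_add_const, hf.funext]

theorem isL2Pi_deriv {f : ℝ → ℂ} (hp : Function.Periodic f (2 * π)) (hf : IsLocallyAC f) :
    IsL2Pi (deriv f) :=
  ⟨periodic_deriv hp, hf.intervalIntegrable_deriv _ _⟩

theorem isL2Pi_iteratedDeriv {f : ℝ → ℂ} (hf : IsL2Pi f) {r : ℕ}
    (hAC : ∀ k < r, IsLocallyAC (iteratedDeriv k f)) : IsL2Pi (iteratedDeriv r f) := by
  induction r with
  | zero => rwa [iteratedDeriv_zero]
  | succ r ih =>
    rw [iteratedDeriv_succ]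
    exact isL2Pi_deriv (ih fun k hk => hAC k (hk.trans r.lt_succ_self)).1 (hAC r r.lt_succ_self)

theorem normL_sub_const_le_two_mul {h : ℝ → ℂ} (hh : IsL2Pi h) {c : ℂ}
    (hc : ∫ x in -π..π, (h x - c) = 0) : normL (fun x => h x - c) ≤ 2 * normL h := by
  have h_const : IsL2Pi fun _ => c := .of_continuous (fun _ => rfl) continuous_const
  have h_mean : ∫ _ in -π..π, c = ∫ x in -π..π, h x := by
    rw [intervalIntegral.integral_sub hh.2 h_const.2] at hc
    exact (sub_eq_zero.1 hc).symm
  have h_normL : normL (fun _ => c) = ‖∫ _ in -π..π, c‖ := by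
    simp only [normL, intervalIntegral.integral_const, norm_smul, smul_eq_mul]
    rw [Real.norm_of_nonneg (sub_nonneg.2 neg_pi_le_pi)]
  calc normL (fun x => h x - c) ≤ normL h + normL fun _ => c := normL_sub_le hh h_const
    _ ≤ normL h + normL h := by
      rw [h_normL, h_mean]
      exact add_le_add_right
        (intervalIntegral.norm_integral_le_integral_norm neg_pi_le_pi) (normL h)
    _ = 2 * normL h := (two_mul _).symm

theorem exists_mem_trigPoly_modulusL_sub_le {f T : ℝ → ℂ} {n : ℕ} (hf : IsL2Pi f)
    (hAC : IsLocallyAC f) (hT : T ∈ trigPoly n) :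
    ∃ Q ∈ trigPoly n, ∀ t, 0 ≤ t → modulusL (f - Q) t ≤ t * (2 * normL (deriv f - T)) := by
  obtain ⟨Q, hQ, c, hQd⟩ := exists_antideriv_of_mem_trigPoly hT
  have hf' := isL2Pi_deriv hf.1 hAC
  have hT' := isL2Pi_of_mem_trigPoly hT
  have h_const : IsL2Pi fun _ => c := .of_continuous (fun _ => rfl) continuous_const
  have h_diff : IsL2Pi fun x => (deriv f - T) x - -c := by
    simp only [sub_neg_eq_add]
    exact (hf'.sub hT').add h_const
  have h_prim : ∀ a b, ∫ x in a..b, ((deriv f - T) x - -c) = (f - Q) b - (f - Q) a := by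
    intro a b
    have h_split : ∀ x, (deriv f - T) x - -c = deriv f x - (T x - c) := fun x => by
      rw [Pi.sub_apply]
      ring
    have h_int : IntervalIntegrable (fun x => T x - c) volume a b :=
      (hT'.sub h_const).intervalIntegrable a b
    simp only [h_split]
    rw [intervalIntegral.integral_sub (hf'.intervalIntegrable a b) h_int,
      hAC.integral_deriv_eq_sub,
      intervalIntegral.integral_eq_sub_of_hasDerivAt (fun x _ => hQd x) h_int]
    simp only [Pi.sub_apply]
    ring
  have h_mean : ∫ x in -π..π, ((deriv f - T) x - -c) = 0 := by
    have h_per := (hf.sub (isL2Pi_of_mem_trigPoly hQ)).1 (-π)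
    rw [show -π + 2 * π = π by ring] at h_per
    rw [h_prim, h_per, sub_self]
  refine ⟨Q, hQ, fun t ht => ?_⟩
  refine (modulusL_le_mul_normL_of_integral_eq_sub h_diff h_prim ht).trans ?_
  gcongr
  exact normL_sub_const_le_two_mul (hf'.sub hT') h_mean

/-- The rate `(n + 1)^{-r} ω(g, (n + 1)⁻¹)_L` of approximation in Jackson's theorem, where `g`
stands for the `r`-th derivative of the function to be approximated. -/
noncomputable def jacksonRate (r : ℕ) (g : ℝ → ℂ) (n : ℕ) : ℝ :=
  ((n : ℝ) + 1) ^ (-(r : ℤ)) * modulusL g ((n : ℝ) + 1)⁻¹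

theorem jacksonRate_succ (r : ℕ) (g : ℝ → ℂ) (n : ℕ) :
    jacksonRate (r + 1) g n = ((n : ℝ) + 1)⁻¹ * jacksonRate r g n := by
  have h_ne : (n : ℝ) + 1 ≠ 0 := by positivity
  rw [jacksonRate, jacksonRate, ← mul_assoc, Nat.cast_succ, neg_add_rev, zpow_add₀ h_ne,
    zpow_neg_one]

theorem exists_forall_mem_trigPoly_normL_sub_le_jacksonRate (r : ℕ) :
    ∃ C : ℝ, 0 ≤ C ∧ ∀ f : ℝ → ℂ, IsL2Pi f → (∀ k < r, IsLocallyAC (iteratedDeriv k f)) →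
      ∀ n, ∃ T ∈ trigPoly n, normL (f - T) ≤ C * jacksonRate r (iteratedDeriv r f) n := by
  induction r with
  | zero =>
    refine ⟨4 * (1 + 32 * π ^ 2), by positivity, fun f hf _ n => ?_⟩
    simpa [jacksonRate] using exists_mem_trigPoly_normL_sub_le_modulusL hf n
  | succ r ih =>
    obtain ⟨C, hC, H⟩ := ih
    refine ⟨4 * (1 + 32 * π ^ 2) * (2 * C), by positivity, fun f hf hAC n => ?_⟩
    have hf0 : IsLocallyAC f := by simpa using hAC 0 r.succ_pos
    obtain ⟨T, hT, hTle⟩ := H (deriv f) (isL2Pi_deriv hf.1 hf0) (fun k hk => by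
      rw [← iteratedDeriv_succ']
      exact hAC (k + 1) (Nat.succ_lt_succ hk)) n
    rw [← iteratedDeriv_succ'] at hTle
    obtain ⟨Q, hQ, hQle⟩ := exists_mem_trigPoly_modulusL_sub_le hf hf0 hT
    obtain ⟨P, hP, hPle⟩ :=
      exists_mem_trigPoly_normL_sub_le_modulusL (hf.sub (isL2Pi_of_mem_trigPoly hQ)) n
    refine ⟨Q + P, Submodule.add_mem _ hQ hP, ?_⟩
    have h_inv : (0 : ℝ) ≤ ((n : ℝ) + 1)⁻¹ := by positivity
    calc normL (f - (Q + P)) = normL (f - Q - P) := by rw [sub_sub]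
      _ ≤ 4 * (1 + 32 * π ^ 2) * (((n : ℝ) + 1)⁻¹ * (2 * normL (deriv f - T))) :=
        hPle.trans (by gcongr; exact hQle _ h_inv)
      _ ≤ 4 * (1 + 32 * π ^ 2) * (((n : ℝ) + 1)⁻¹ *
            (2 * (C * jacksonRate r (iteratedDeriv (r + 1) f) n))) := by gcongr
      _ = _ := by
        rw [jacksonRate_succ]
        ring

/-! ### De la Vallée Poussin means -/

theorem normL_smul (c : ℂ) (g : ℝ → ℂ) : normL (c • g) = ‖c‖ * normL g := by
  simp only [normL, Pi.smul_apply, norm_smul, intervalIntegral.integral_const_mul]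

theorem normL_sum_le {ι : Type*} (s : Finset ι) {F : ι → ℝ → ℂ} (hF : ∀ i ∈ s, IsL2Pi (F i)) :
    normL (∑ i ∈ s, F i) ≤ ∑ i ∈ s, normL (F i) :=
  Finset.le_sum_of_subadditive_on_pred normL IsL2Pi (by simp [normL])
    (fun _ _ => normL_add_le) (fun _ _ => IsL2Pi.add) F hF

/-- The de la Vallée Poussin mean of `f`, written as the average of the `n + 1` sums of the Fourier
series over the windows of length `3n + 1` that contain `[-n, n]`. -/
noncomputable def vpMean (f : ℝ → ℂ) (n : ℕ) : ℝ → ℂ :=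
  ((n : ℂ) + 1)⁻¹ • ∑ i ∈ Finset.range (n + 1),
    ∑ k ∈ Finset.Icc (i - 2 * n : ℤ) (i + n), fhat f k • expZ k

/-- The de la Vallée Poussin kernel, whose convolution with `f` is `vpMean f n`. -/
noncomputable def vpKernel (n : ℕ) : ℝ → ℂ :=
  ∑ p ∈ Finset.range (n + 1) ×ˢ Finset.Icc (-2 * n : ℤ) n,
    (2 * (π : ℂ) * (n + 1))⁻¹ • expZ (p.1 + p.2)

theorem vpKernel_apply (n : ℕ) (x : ℝ) :
    vpKernel n x = (2 * (π : ℂ) * (n + 1))⁻¹ *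
      (geomExp (n + 1) x * ∑ j ∈ Finset.Icc (-2 * n : ℤ) n, expZ j x) := by
  rw [geomExp, Finset.sum_mul_sum, ← Finset.sum_product', Finset.mul_sum, vpKernel]
  simp only [Finset.sum_apply, Pi.smul_apply, smul_eq_mul, expZ_add]

theorem continuous_vpKernel (n : ℕ) : Continuous (vpKernel n) :=
  continuous_sum_smul_expZ _ _ _

-- The kernel is a product of two sums of exponentials, so `2ab ≤ a² + b²` and Parseval bound it.
theorem normL_vpKernel_le (n : ℕ) : normL (vpKernel n) ≤ 2 := by
  have h_card : ((Finset.Icc (-2 * n : ℤ) n).card : ℝ) = 3 * n + 1 := by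
    rw [Int.card_Icc]
    exact_mod_cast (by lia : ((n : ℤ) + 1 - -2 * n).toNat = 3 * n + 1)
  have h_const : ‖(2 * (π : ℂ) * (n + 1))⁻¹‖ = (2 * π * (n + 1))⁻¹ := by
    rw [norm_inv, norm_mul, norm_mul, Complex.norm_real, Real.norm_of_nonneg Real.pi_pos.le,
      Complex.norm_ofNat]
    norm_cast
  have h_geom : Continuous fun x => ‖geomExp (n + 1) x‖ ^ 2 :=
    (continuous_geomExp _).norm.pow 2
  have h_wide : Continuous fun x => ‖∑ j ∈ Finset.Icc (-2 * n : ℤ) n, expZ j x‖ ^ 2 :=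
    (continuous_finsetSum _ fun j _ => continuous_expZ j).norm.pow 2
  calc normL (vpKernel n) ≤ ∫ x in -π..π, (2 * π * (n + 1))⁻¹ * (1 / 2) *
        (‖geomExp (n + 1) x‖ ^ 2 + ‖∑ j ∈ Finset.Icc (-2 * n : ℤ) n, expZ j x‖ ^ 2) := by
        refine intervalIntegral.integral_mono_on neg_pi_le_pi
          ((continuous_vpKernel n).norm.intervalIntegrable _ _)
          ((continuous_const.mul (h_geom.add h_wide)).intervalIntegrable _ _) fun x _ => ?_
        rw [vpKernel_apply, norm_mul, norm_mul, h_const, mul_assoc (2 * π * ((n : ℝ) + 1))⁻¹]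
        refine mul_le_mul_of_nonneg_left ?_ (by positivity)
        linarith [two_mul_le_add_sq ‖geomExp (n + 1) x‖
          ‖∑ j ∈ Finset.Icc (-2 * n : ℤ) n, expZ j x‖]
    _ = (2 * π * (n + 1))⁻¹ * (1 / 2) * (2 * π * (n + 1) + 2 * π * (3 * n + 1)) := by
        rw [intervalIntegral.integral_const_mul, intervalIntegral.integral_add
          (h_geom.intervalIntegrable _ _) (h_wide.intervalIntegrable _ _),
          integral_norm_geomExp_sq, integral_norm_sum_expZ_sq, h_card, Nat.cast_succ]
    _ = 2 - ((n : ℝ) + 1)⁻¹ := by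
        field_simp
        ring
    _ ≤ 2 := sub_le_self _ (by positivity)

theorem vpMean_eq_perConv {f : ℝ → ℂ} (hf : IsL2Pi f) (n : ℕ) :
    vpMean f n = perConv f (vpKernel n) := by
  have h_window : ∀ i : ℕ, ∑ k ∈ Finset.Icc (i - 2 * n : ℤ) (i + n), fhat f k • expZ k =
      ∑ j ∈ Finset.Icc (-2 * n : ℤ) n, fhat f (i + j) • expZ (i + j) := fun i => by
    rw [sub_eq_add_neg, ← neg_mul, ← Finset.image_add_left_Icc,
      Finset.sum_image (fun _ _ _ _ h => add_left_cancel h)]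
  have h_const : ∀ z : ℂ, 2 * π * ((2 * (π : ℂ) * (n + 1))⁻¹ * z) = ((n : ℂ) + 1)⁻¹ * z :=
    fun z => by
      have hπ : (π : ℂ) ≠ 0 := by exact_mod_cast Real.pi_ne_zero
      have hn : (n : ℂ) + 1 ≠ 0 := Nat.cast_add_one_ne_zero n
      field_simp
  rw [vpKernel, perConv_sum_smul_expZ hf, vpMean]
  simp only [h_window, h_const, mul_smul, Finset.sum_product, Finset.smul_sum]

theorem isL2Pi_vpMean (f : ℝ → ℂ) (n : ℕ) : IsL2Pi (vpMean f n) := by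
  rw [vpMean, Finset.sum_sigma', Finset.smul_sum]
  simp only [smul_smul]
  exact isL2Pi_sum_smul_expZ _ _ _

theorem normL_vpMean_le {f : ℝ → ℂ} (hf : IsL2Pi f) (n : ℕ) :
    normL (vpMean f n) ≤ 2 * normL f := by
  rw [vpMean_eq_perConv hf, mul_comm]
  exact (normL_perConv_le hf ((continuous_vpKernel n).intervalIntegrable _ _)).trans
    (mul_le_mul_of_nonneg_left (normL_vpKernel_le n) (normL_nonneg f))

theorem vpMean_of_mem_trigPoly {n : ℕ} {T : ℝ → ℂ} (hT : T ∈ trigPoly n) : vpMean T n = T := by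
  have h_window : ∀ i ∈ Finset.range (n + 1),
      ∑ k ∈ Finset.Icc (i - 2 * n : ℤ) (i + n), fhat T k • expZ k = T := fun i hi => by
    rw [Finset.mem_range] at hi
    exact sum_fhat_smul_expZ_of_mem_trigPoly hT (Finset.Icc_subset_Icc (by lia) (by lia))
  rw [vpMean, Finset.sum_congr rfl h_window, Finset.sum_const, Finset.card_range,
    ← Nat.cast_smul_eq_nsmul ℂ, Nat.cast_succ, inv_smul_smul₀ (Nat.cast_add_one_ne_zero n)]

theorem vpMean_sub {f g : ℝ → ℂ} (hf : IsL2Pi f) (hg : IsL2Pi g) (n : ℕ) :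
    vpMean (f - g) n = vpMean f n - vpMean g n := by
  simp only [vpMean, fhat_sub hf hg, sub_smul, Finset.sum_sub_distrib, smul_sub]

theorem normL_sub_vpMean_le {f T : ℝ → ℂ} {n : ℕ} (hf : IsL2Pi f) (hT : T ∈ trigPoly n) :
    normL (f - vpMean f n) ≤ 3 * normL (f - T) := by
  have hd := hf.sub (isL2Pi_of_mem_trigPoly hT)
  have h_eq : f - vpMean f n = (f - T) - vpMean (f - T) n := by
    rw [vpMean_sub hf (isL2Pi_of_mem_trigPoly hT), vpMean_of_mem_trigPoly hT,
      sub_sub_sub_cancel_right]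
  calc normL (f - vpMean f n) ≤ normL (f - T) + normL (vpMean (f - T) n) := by
        rw [h_eq]
        exact normL_sub_le hd (isL2Pi_vpMean _ _)
    _ ≤ 3 * normL (f - T) := by linarith [normL_vpMean_le hd n]

theorem sum_Icc_add_natCast {E : Type*} [AddCommMonoid E] {a b : ℤ} (hab : a ≤ b + 1) (G : ℤ → E)
    (q : ℕ) : ∑ k ∈ Finset.Icc a (b + q), G k =
      ∑ k ∈ Finset.Icc a b, G k + ∑ j ∈ Finset.range q, G (b + 1 + j) := by
  induction q with
  | zero => simp
  | succ q ih =>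
    rw [Nat.cast_succ, ← add_assoc, ← Finset.insert_Icc_right_eq_Icc_add_one (by lia),
      Finset.sum_insert (by simp), ih, Finset.sum_range_succ, add_right_comm b, add_comm, add_assoc]

theorem sum_Icc_sub_natCast {E : Type*} [AddCommMonoid E] {a b : ℤ} (hab : a ≤ b + 1) (G : ℤ → E)
    (p : ℕ) : ∑ k ∈ Finset.Icc (a - p) b, G k =
      ∑ k ∈ Finset.Icc a b, G k + ∑ j ∈ Finset.range p, G (a - 1 - j) := by
  have h := sum_Icc_add_natCast (by lia : -b ≤ -a + 1) (fun k => G (-k)) p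
  have h_neg : ∀ c d : ℤ, ∑ k ∈ Finset.Icc (-d) (-c), G (-k) = ∑ k ∈ Finset.Icc c d, G k :=
    fun c d => Finset.sum_equiv (Equiv.neg ℤ) (fun k => by
      rw [Equiv.neg_apply, Finset.mem_Icc, Finset.mem_Icc]
      lia) fun _ _ => rfl
  rw [h_neg, (by ring : -a + p = -(a - p)), h_neg] at h
  simpa only [neg_add', neg_neg] using h

/-- The block of length `L` of the series `∑ c k e^{ikx}` that begins after the frequency `n`. -/
noncomputable def expBlock (c : ℕ → ℂ) (n L : ℕ) : ℝ → ℂ :=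
  ∑ j ∈ Finset.range L, c (n + 1 + j) • expZ (n + 1 + j)

theorem isL2Pi_expBlock (c : ℕ → ℂ) (n L : ℕ) : IsL2Pi (expBlock c n L) :=
  isL2Pi_sum_smul_expZ _ _ _

theorem expBlock_apply_neg (c : ℕ → ℂ) (n L : ℕ) :
    (fun x => expBlock c n L (-x)) =
      ∑ j ∈ Finset.range L, c (n + 1 + j) • expZ (-(n : ℤ) - 1 - j) := by
  funext x
  simp only [expBlock, Finset.sum_apply, Pi.smul_apply, expZ_apply_neg, neg_add']

theorem vpMean_sub_partialSum (f : ℝ → ℂ) (n : ℕ) :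
    vpMean f n - partialSum f n = ((n : ℂ) + 1)⁻¹ • ∑ i ∈ Finset.range (n + 1),
      (expBlock (fun k => fhat f k) n i +
        fun x => expBlock (fun k => fhat f (-k)) n (n - i) (-x)) := by
  have h_window : ∀ i ∈ Finset.range (n + 1),
      ∑ k ∈ Finset.Icc (i - 2 * n : ℤ) (i + n), fhat f k • expZ k = partialSum f n +
        (expBlock (fun k => fhat f k) n i +
          fun x => expBlock (fun k => fhat f (-k)) n (n - i) (-x)) := fun i hi => by
    rw [Finset.mem_range] at hi
    have h_ends : Finset.Icc (i - 2 * n : ℤ) (i + n) =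
        Finset.Icc (-n - (n - i : ℕ) : ℤ) (n + i) := by congr 1 <;> lia
    rw [h_ends, sum_Icc_sub_natCast (by lia), sum_Icc_add_natCast (by lia), expBlock_apply_neg,
      partialSum_eq_sum_smul, expBlock, add_assoc]
    simp only [Nat.cast_add, Nat.cast_one, neg_add']
  rw [vpMean, Finset.sum_congr rfl h_window, Finset.sum_add_distrib, smul_add, Finset.sum_const,
    Finset.card_range, ← Nat.cast_smul_eq_nsmul ℂ, Nat.cast_succ,
    inv_smul_smul₀ (Nat.cast_add_one_ne_zero n), add_sub_cancel_left]

theorem normL_vpMean_sub_partialSum_le (f : ℝ → ℂ) {n : ℕ} {B₁ B₂ : ℝ}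
    (hpos : ∀ L ≤ n, normL (expBlock (fun k => fhat f k) n L) ≤ B₁)
    (hneg : ∀ L ≤ n, normL (expBlock (fun k => fhat f (-k)) n L) ≤ B₂) :
    normL (vpMean f n - partialSum f n) ≤ B₁ + B₂ := by
  have hL := isL2Pi_expBlock
  have h_term : ∀ i ∈ Finset.range (n + 1), normL (expBlock (fun k => fhat f k) n i +
      fun x => expBlock (fun k => fhat f (-k)) n (n - i) (-x)) ≤ B₁ + B₂ := fun i hi => by
    refine (normL_add_le (hL _ n i) (hL _ n (n - i)).comp_neg).trans ?_
    rw [normL_comp_neg]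
    exact add_le_add (hpos i (Nat.lt_succ_iff.1 (Finset.mem_range.1 hi))) (hneg _ (n.sub_le i))
  have h_norm : ‖((n : ℂ) + 1)⁻¹‖ = ((n : ℝ) + 1)⁻¹ := by
    rw [norm_inv]
    norm_cast
  rw [vpMean_sub_partialSum, normL_smul, h_norm, inv_mul_le_iff₀ (by positivity)]
  refine (normL_sum_le _ fun i _ => (hL _ n i).add (hL _ n (n - i)).comp_neg).trans ?_
  refine (Finset.sum_le_card_nsmul _ _ _ h_term).trans_eq ?_
  rw [Finset.card_range, nsmul_eq_mul, Nat.cast_succ]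

/-! ### Summation by parts -/

theorem norm_sum_smul_le_of_norm_sum_le {𝕜 E : Type*} [NormedField 𝕜] [NormedAddCommGroup E]
    [NormedSpace 𝕜 E] {a : ℕ → 𝕜} {b : ℕ → E} {L : ℕ} {B : ℝ}
    (hB : ∀ j ≤ L, ‖∑ i ∈ Finset.range j, b i‖ ≤ B) :
    ‖∑ i ∈ Finset.range L, a i • b i‖ ≤
      B * (‖a (L - 1)‖ + ∑ i ∈ Finset.range (L - 1), ‖a i - a (i + 1)‖) := by
  rw [Finset.sum_range_by_parts, mul_add, mul_comm B, Finset.mul_sum]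
  refine (norm_sub_le _ _).trans (add_le_add ?_ ((norm_sum_le _ _).trans
    (Finset.sum_le_sum fun i hi => ?_)))
  · rw [norm_smul]
    exact mul_le_mul_of_nonneg_left (hB L le_rfl) (norm_nonneg _)
  · rw [Finset.mem_range] at hi
    rw [norm_smul, norm_sub_rev, mul_comm]
    exact mul_le_mul_of_nonneg_right (hB _ (by lia)) (norm_nonneg _)

theorem norm_sum_smul_le_of_antitone {E : Type*} [NormedAddCommGroup E] [NormedSpace ℝ E]
    {v : ℕ → ℝ} (hv : Antitone v) (hv0 : ∀ i, 0 ≤ v i) {b : ℕ → E} {L : ℕ} {B : ℝ}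
    (hB : ∀ j ≤ L, ‖∑ i ∈ Finset.range j, b i‖ ≤ B) :
    ‖∑ i ∈ Finset.range L, v i • b i‖ ≤ B * v 0 := by
  have h_diff : ∀ i, ‖v i - v (i + 1)‖ = v i - v (i + 1) := fun i =>
    Real.norm_of_nonneg (sub_nonneg.2 (hv i.le_succ))
  refine (norm_sum_smul_le_of_norm_sum_le hB).trans_eq ?_
  simp only [h_diff, Real.norm_of_nonneg (hv0 _)]
  rw [Finset.sum_range_sub', add_sub_cancel]

theorem sum_expZ_add (m : ℤ) (L : ℕ) (x : ℝ) :
    ∑ j ∈ Finset.range L, expZ (m + j) x = expZ m x * geomExp L x := by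
  simp only [expZ_add, geomExp, Finset.mul_sum]

theorem continuous_abs_add_inv {ε : ℝ} (hε : 0 < ε) : Continuous fun x : ℝ => (|x| + ε)⁻¹ :=
  (continuous_abs.add continuous_const).inv₀ fun x => (by positivity : 0 < |x| + ε).ne'

theorem integral_abs_add_inv {b ε : ℝ} (hb : 0 ≤ b) (hε : 0 < ε) :
    ∫ x in -b..b, (|x| + ε)⁻¹ = 2 * Real.log ((b + ε) / ε) := by
  have hc := continuous_abs_add_inv hε
  have h_right : ∫ x in 0..b, (|x| + ε)⁻¹ = Real.log ((b + ε) / ε) := by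
    have h_abs : Set.EqOn (fun x => (|x| + ε)⁻¹) (fun x => (x + ε)⁻¹) (Set.uIcc 0 b) :=
      fun x hx => by
        rw [Set.uIcc_of_le hb] at hx
        simp only [abs_of_nonneg hx.1]
    rw [intervalIntegral.integral_congr h_abs,
      intervalIntegral.integral_comp_add_right (fun x => x⁻¹), zero_add,
      integral_inv_of_pos hε (by positivity)]
  have h_left : ∫ x in -b..0, (|x| + ε)⁻¹ = ∫ x in 0..b, (|x| + ε)⁻¹ := by
    simpa only [abs_neg, neg_zero] using
      (intervalIntegral.integral_comp_neg (a := 0) (b := b) fun x => (|x| + ε)⁻¹).symm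
  rw [← intervalIntegral.integral_add_adjacent_intervals (hc.intervalIntegrable (-b) 0)
    (hc.intervalIntegrable 0 b), h_left, h_right, two_mul]

theorem log_pi_mul_add_one_le {y : ℝ} (hy : 0 ≤ y) :
    Real.log (π * y + 1) ≤ 4 * Real.log (y + 1) := by
  have h_bernoulli : π * y + 1 ≤ (y + 1) ^ 4 := by
    rw [add_comm y]
    have h := one_add_mul_le_pow (by linarith : -2 ≤ y) 4
    rw [Nat.cast_ofNat] at h
    linarith [mul_le_mul_of_nonneg_right Real.pi_le_four hy]
  refine (Real.log_le_log (by positivity) h_bernoulli).trans_eq ?_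
  rw [Real.log_pow, Nat.cast_ofNat]

theorem normL_sum_smul_expZ_le (a : ℕ → ℂ) (m : ℤ) {n L : ℕ} (hL : L ≤ n) :
    normL (∑ j ∈ Finset.range L, a j • expZ (m + j)) ≤ 8 * (1 + π) * Real.log (n + 1) *
      (‖a (L - 1)‖ + ∑ i ∈ Finset.range (L - 1), ‖a i - a (i + 1)‖) := by
  rcases n.eq_zero_or_pos with rfl | hn
  · simp [Nat.le_zero.1 hL, normL]
  have hn' : (0 : ℝ) < (n : ℝ)⁻¹ := by positivity
  set V := ‖a (L - 1)‖ + ∑ i ∈ Finset.range (L - 1), ‖a i - a (i + 1)‖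
  have h_point : ∀ x ∈ Set.Icc (-π) π, ‖(∑ j ∈ Finset.range L, a j • expZ (m + j)) x‖ ≤
      (1 + π) * V * (|x| + (n : ℝ)⁻¹)⁻¹ := fun x hx => by
    rw [Finset.sum_apply, mul_right_comm]
    refine norm_sum_smul_le_of_norm_sum_le (a := a) (b := fun j => expZ (m + j) x) fun j hj => ?_
    rw [sum_expZ_add, norm_mul, norm_expZ, one_mul]
    exact norm_geomExp_le_div (hj.trans hL) hn.ne' (abs_le.2 hx)
  calc normL (∑ j ∈ Finset.range L, a j • expZ (m + j))
      ≤ ∫ x in -π..π, (1 + π) * V * (|x| + (n : ℝ)⁻¹)⁻¹ :=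
        intervalIntegral.integral_mono_on neg_pi_le_pi
          ((continuous_sum_smul_expZ _ _ _).norm.intervalIntegrable _ _)
          ((continuous_const.mul (continuous_abs_add_inv hn')).intervalIntegrable _ _) h_point
    _ = (1 + π) * V * (2 * Real.log (π * n + 1)) := by
        rw [intervalIntegral.integral_const_mul, integral_abs_add_inv Real.pi_pos.le hn', add_div,
          div_self hn'.ne', div_inv_eq_mul]
    _ ≤ (1 + π) * V * (2 * (4 * Real.log (n + 1))) := by
        gcongr
        exact log_pi_mul_add_one_le n.cast_nonneg
    _ = 8 * (1 + π) * Real.log (n + 1) * V := by ring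

/-! ### The sawtooth series -/

theorem norm_sum_inv_smul_expZ_le {x : ℝ} (hx0 : 0 < x) (hx : x ≤ π) {p : ℕ}
    (hp : 1 ≤ (p + 1) * x) (L : ℕ) :
    ‖∑ j ∈ Finset.range L, ((p + j : ℕ) + 1 : ℝ)⁻¹ • expZ (p + 1 + j) x‖ ≤ π := by
  have hB : ∀ j ≤ L, ‖∑ i ∈ Finset.range j, expZ (p + 1 + i) x‖ ≤ π / x := fun j _ => by
    rw [sum_expZ_add, norm_mul, norm_expZ, one_mul, le_div_iff₀ hx0]
    simpa only [abs_of_pos hx0] using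
      norm_geomExp_mul_abs_le j (x := x) (by rwa [abs_of_pos hx0])
  have h_anti : Antitone fun j : ℕ => ((p + j : ℕ) + 1 : ℝ)⁻¹ := fun i j hij => by
    dsimp only
    gcongr
  refine (norm_sum_smul_le_of_antitone h_anti (fun j => by positivity) hB).trans ?_
  rw [add_zero, div_mul_eq_mul_div, div_le_iff₀ hx0]
  gcongr
  exact (inv_le_iff_one_le_mul₀' (by positivity)).2 hp

theorem abs_sum_sin_div_le_mul (p : ℕ) {x : ℝ} (hx : 0 ≤ x) :
    |∑ k ∈ Finset.range p, (k + 1 : ℝ)⁻¹ * Real.sin ((k + 1) * x)| ≤ p * x := by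
  refine (Finset.abs_sum_le_sum_abs _ _).trans
    ((Finset.sum_le_card_nsmul _ _ x fun k _ => ?_).trans_eq ?_)
  · rw [abs_mul, abs_of_nonneg (by positivity), inv_mul_le_iff₀ (by positivity)]
    exact Real.abs_sin_le_abs.trans_eq (abs_of_nonneg (by positivity))
  · rw [Finset.card_range, nsmul_eq_mul]

-- The terms with `k ≤ 1/x` are estimated by `|sin y| ≤ |y|`, the others by summation by parts.
theorem abs_sum_sin_div_le_of_pos {x : ℝ} (hx0 : 0 < x) (hx : x ≤ π) (N : ℕ) :
    |∑ k ∈ Finset.range N, (k + 1 : ℝ)⁻¹ * Real.sin ((k + 1) * x)| ≤ 1 + π := by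
  obtain ⟨p, hp⟩ : ∃ p, p = ⌊x⁻¹⌋₊ := ⟨_, rfl⟩
  have hp_le : p * x ≤ 1 := by
    rw [← le_div_iff₀ hx0, one_div, hp]
    exact Nat.floor_le (by positivity)
  have hp_gt : 1 ≤ (p + 1) * x := by
    rw [← div_le_iff₀ hx0, one_div, hp]
    exact (Nat.lt_floor_add_one _).le
  rcases le_total N p with h | h
  · have hN : N * x ≤ p * x := by gcongr
    linarith [abs_sum_sin_div_le_mul N hx0.le, Real.pi_pos]
  · obtain ⟨L, rfl⟩ := Nat.exists_eq_add_of_le h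
    have h_im : ∑ j ∈ Finset.range L, ((p + j : ℕ) + 1 : ℝ)⁻¹ * Real.sin (((p + j : ℕ) + 1) * x) =
        (∑ j ∈ Finset.range L, ((p + j : ℕ) + 1 : ℝ)⁻¹ • expZ (p + 1 + j) x).im := by
      rw [Complex.im_sum]
      refine Finset.sum_congr rfl fun j _ => ?_
      rw [Complex.smul_im, expZ_eq_exp_mul_I, Complex.exp_ofReal_mul_I_im, smul_eq_mul]
      push_cast
      rw [add_right_comm (p : ℝ)]
    rw [Finset.sum_range_add, h_im]
    exact (abs_add_le _ _).trans (add_le_add ((abs_sum_sin_div_le_mul p hx0.le).trans hp_le)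
      ((Complex.abs_im_le_norm _).trans (norm_sum_inv_smul_expZ_le hx0 hx hp_gt L)))

theorem abs_sum_sin_div_le {x : ℝ} (hx : |x| ≤ π) (N : ℕ) :
    |∑ k ∈ Finset.range N, (k + 1 : ℝ)⁻¹ * Real.sin ((k + 1) * x)| ≤ 1 + π := by
  rcases eq_or_ne x 0 with rfl | hx0
  · simp only [mul_zero, Real.sin_zero, Finset.sum_const_zero, abs_zero]
    positivity
  have h := abs_sum_sin_div_le_of_pos (abs_pos.2 hx0) hx N
  rcases abs_choice x with hx' | hx' <;> rw [hx'] at h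
  · exact h
  · simpa only [mul_neg, Real.sin_neg, Finset.sum_neg_distrib, abs_neg] using h

theorem expZ_neg_mul_sin (n : ℤ) (k : ℕ) (x : ℝ) :
    expZ (-n) x * (Real.sin ((k + 1) * x) : ℝ) =
      Complex.I / 2 * (expZ (-(n + (k + 1))) x - expZ (-(n - (k + 1))) x) := by
  have h_sin : ((Real.sin ((k + 1) * x) : ℝ) : ℂ) =
      (expZ (-(k + 1)) x - expZ (k + 1) x) * Complex.I / 2 := by
    rw [Complex.ofReal_sin, Complex.sin, expZ_eq_exp_mul_I, expZ_eq_exp_mul_I]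
    push_cast
    ring_nf
  rw [h_sin, neg_add n, expZ_add (-n), neg_sub', sub_neg_eq_add, expZ_add (-n)]
  ring

-- Testing `h` against the bounded function `e^{-inx} ∑ sin((k + 1)x) / (k + 1)`.
theorem norm_sum_inv_mul_fhat_sub_le {h : ℝ → ℂ} (hh : IsL2Pi h) (n : ℤ) (N : ℕ) :
    ‖∑ k ∈ Finset.range N, ((k : ℂ) + 1)⁻¹ * (fhat h (n + (k + 1)) - fhat h (n - (k + 1)))‖ ≤
      2 * normL h := by
  have h_integrable : ∀ l : ℤ, IntervalIntegrable (fun x => h x * expZ l x) volume (-π) π :=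
    fun l => (hh.mul_continuous (expZ_periodic l) (continuous_expZ l)).2
  have h_term : ∀ k : ℕ, ∫ x in -π..π, ((k : ℂ) + 1)⁻¹ * (Complex.I / 2) *
      (h x * expZ (-(n + (k + 1))) x - h x * expZ (-(n - (k + 1))) x) =
        π * Complex.I *
          (((k : ℂ) + 1)⁻¹ * (fhat h (n + (k + 1)) - fhat h (n - (k + 1)))) := fun k => by
    rw [intervalIntegral.integral_const_mul,
      intervalIntegral.integral_sub (h_integrable _) (h_integrable _),
      integral_mul_expZ_neg, integral_mul_expZ_neg]
    ring
  have h_pairing : ∫ x in -π..π, h x * (expZ (-n) x *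
      ((∑ k ∈ Finset.range N, (k + 1 : ℝ)⁻¹ * Real.sin ((k + 1) * x) : ℝ) : ℂ)) =
      π * Complex.I * ∑ k ∈ Finset.range N,
        ((k : ℂ) + 1)⁻¹ * (fhat h (n + (k + 1)) - fhat h (n - (k + 1))) := by
    rw [Finset.mul_sum, ← Finset.sum_congr rfl fun k _ => h_term k,
      ← intervalIntegral.integral_finsetSum fun k _ =>
        ((h_integrable _).sub (h_integrable _)).const_mul _]
    refine intervalIntegral.integral_congr fun x _ => ?_
    simp only [Complex.ofReal_sum, Finset.mul_sum]
    refine Finset.sum_congr rfl fun k _ => ?_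
    rw [Complex.ofReal_mul, mul_left_comm (expZ _ _), expZ_neg_mul_sin]
    push_cast
    ring
  have h_bound := (congrArg norm h_pairing).symm.trans_le
    (norm_integral_mul_le hh (B := 1 + π) fun x hx => by
      rw [norm_mul, norm_expZ, one_mul, Complex.norm_real]
      exact abs_sum_sin_div_le hx N)
  rw [norm_mul, norm_mul, Complex.norm_I, mul_one, Complex.norm_real,
    Real.norm_of_nonneg Real.pi_pos.le] at h_bound
  have h_const : (1 + π) * normL h ≤ π * (2 * normL h) := by
    nlinarith [normL_nonneg h, Real.pi_gt_three]
  exact le_of_mul_le_mul_left (h_bound.trans h_const) Real.pi_pos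

/-! ### Sequences of class GBV -/

theorem cos_mul_norm_le_re_of_mem_sectorK {θ : ℝ} (hθ : θ ≤ π) {z : ℂ} (hz : z ∈ sectorK θ) :
    Real.cos θ * ‖z‖ ≤ z.re := by
  have h_cos : Real.cos θ ≤ Real.cos (Complex.arg z) := by
    rw [← Real.cos_abs (Complex.arg z)]
    exact Real.cos_le_cos_of_nonneg_of_le_pi (abs_nonneg _) hθ hz
  rw [← Complex.norm_mul_cos_arg z, mul_comm]
  exact mul_le_mul_of_nonneg_left h_cos (norm_nonneg z)

theorem cos_mul_sum_norm_le_norm_sum {θ : ℝ} (hθ : θ ≤ π) {ι : Type*} {s : Finset ι} {a : ι → ℝ}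
    {z : ι → ℂ} (ha : ∀ i ∈ s, 0 ≤ a i) (hz : ∀ i ∈ s, z i ∈ sectorK θ) :
    Real.cos θ * ∑ i ∈ s, a i * ‖z i‖ ≤ ‖∑ i ∈ s, (a i : ℂ) * z i‖ := by
  refine le_trans ?_ (Complex.re_le_norm _)
  rw [Complex.re_sum, Finset.mul_sum]
  refine Finset.sum_le_sum fun i hi => ?_
  rw [Complex.re_ofReal_mul, mul_left_comm]
  exact mul_le_mul_of_nonneg_left (cos_mul_norm_le_re_of_mem_sectorK hθ (hz i hi)) (ha i hi)

theorem sup_nnnorm_Ico_le_sum {E : Type*} [SeminormedAddCommGroup E] (c : ℕ → E) (m N₀ : ℕ) :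
    (((Finset.Ico m (m + N₀)).sup fun n => ‖c n‖₊ : NNReal) : ℝ) ≤
      ∑ i ∈ Finset.range N₀, ‖c (m + i)‖ := by
  have h : ((Finset.Ico m (m + N₀)).sup fun n => ‖c n‖₊) ≤ ∑ n ∈ Finset.Ico m (m + N₀), ‖c n‖₊ :=
    Finset.sup_le fun n hn => Finset.single_le_sum (f := fun n => ‖c n‖₊) (fun _ _ => zero_le) hn
  rw [Finset.sum_Ico_eq_sum_range, add_tsub_cancel_left] at h
  simpa only [NNReal.coe_sum, coe_nnnorm] using NNReal.coe_le_coe.2 h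

theorem IsGBV.exists_norm_add_sum_Ico_le {c : ℕ → ℂ} (hc : IsGBV c) :
    ∃ N₀ : ℕ, 1 ≤ N₀ ∧ ∃ M : ℝ, 0 < M ∧ ∀ m N : ℕ, 1 ≤ m → m ≤ N → N ≤ 2 * m + 1 →
      ‖c N‖ + ∑ n ∈ Finset.Ico m N, ‖c n - c (n + 1)‖ ≤
        M * ∑ i ∈ Finset.range N₀, ‖c (m + i)‖ := by
  obtain ⟨-, N₀, hN₀, M, hM, hvar⟩ := hc
  refine ⟨N₀, hN₀, 1 + 2 * M, by positivity, fun m N hm hmN hNm => ?_⟩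
  have h_first : ‖c m‖ ≤ ∑ i ∈ Finset.range N₀, ‖c (m + i)‖ :=
    Finset.single_le_sum (f := fun i => ‖c (m + i)‖) (fun _ _ => norm_nonneg _)
      (Finset.mem_range.2 hN₀)
  have h_last : ‖c N‖ ≤ ‖c m‖ + ∑ n ∈ Finset.Ico m N, ‖c n - c (n + 1)‖ := by
    have h := dist_le_Ico_sum_dist c hmN
    simp only [dist_eq_norm] at h
    linarith [norm_le_norm_add_norm_sub (c m) (c N)]
  have h_var : ∑ n ∈ Finset.Ico m N, ‖c n - c (n + 1)‖ ≤
      M * ∑ i ∈ Finset.range N₀, ‖c (m + i)‖ := by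
    refine (Finset.sum_le_sum_of_subset_of_nonneg (fun n hn => ?_) fun _ _ _ => norm_nonneg _).trans
      ((hvar m hm).trans (mul_le_mul_of_nonneg_left (sup_nnnorm_Ico_le_sum c m N₀) hM.le))
    rw [Finset.mem_Ico] at hn
    rw [Finset.mem_Icc]
    lia
  linarith

theorem sum_range_add_le {u : ℕ → ℝ} (hu : ∀ k, 0 ≤ u k) {i m : ℕ} (hi : i ≤ m) (n : ℕ) :
    ∑ k ∈ Finset.range n, u (k + i) ≤ ∑ k ∈ Finset.range (n + m), u k := by
  rw [Finset.range_eq_Ico, Finset.range_eq_Ico, Finset.sum_Ico_add']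
  exact Finset.sum_le_sum_of_subset_of_nonneg (Finset.Ico_subset_Ico (by lia) (by lia))
    fun _ _ _ => hu _

theorem inv_add_one_le_mul_inv {i N₀ : ℕ} (hi : i < N₀) (k : ℕ) :
    ((k : ℝ) + 1)⁻¹ ≤ N₀ * (((k + i : ℕ) : ℝ) + 1)⁻¹ := by
  rw [← div_eq_mul_inv, le_div_iff₀ (by positivity), inv_mul_le_iff₀ (by positivity)]
  have h : k + i + 1 ≤ (k + 1) * N₀ := by nlinarith
  exact_mod_cast h

-- If `A` is at most `M` times every window sum of `w`, averaging over the windows with the weights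
-- of the harmonic series gains a logarithm.
theorem mul_log_le_sum_inv_mul {w : ℕ → ℝ} (hw : ∀ k, 0 ≤ w k) {A M : ℝ} (hA : 0 ≤ A) (hM : 0 ≤ M)
    {N₀ n : ℕ} (hN₀ : N₀ ≤ n) (h : ∀ k < n, A ≤ M * ∑ i ∈ Finset.range N₀, w (k + i)) :
    A * Real.log (n + 1) ≤
      M * N₀ ^ 2 * ∑ k ∈ Finset.range (2 * n), ((k : ℝ) + 1)⁻¹ * w k := by
  set u : ℕ → ℝ := fun k => ((k : ℝ) + 1)⁻¹ * w k
  have h_term : ∀ k ∈ Finset.range n,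
      ((k : ℝ) + 1)⁻¹ * A ≤ M * N₀ * ∑ i ∈ Finset.range N₀, u (k + i) := fun k hk => by
    calc ((k : ℝ) + 1)⁻¹ * A ≤ ((k : ℝ) + 1)⁻¹ * (M * ∑ i ∈ Finset.range N₀, w (k + i)) := by
          gcongr
          exact h k (Finset.mem_range.1 hk)
      _ = M * ∑ i ∈ Finset.range N₀, ((k : ℝ) + 1)⁻¹ * w (k + i) := by
          rw [mul_left_comm, Finset.mul_sum]
      _ ≤ M * ∑ i ∈ Finset.range N₀, N₀ * (((k + i : ℕ) : ℝ) + 1)⁻¹ * w (k + i) := by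
          gcongr with i hi
          · exact hw _
          · exact inv_add_one_le_mul_inv (Finset.mem_range.1 hi) k
      _ = M * N₀ * ∑ i ∈ Finset.range N₀, u (k + i) := by
          simp only [u, mul_assoc, Finset.mul_sum]
  calc A * Real.log (n + 1) ≤ A * ∑ k ∈ Finset.range n, ((k : ℝ) + 1)⁻¹ := by
        gcongr
        simpa [harmonic] using log_add_one_le_harmonic n
    _ = ∑ k ∈ Finset.range n, ((k : ℝ) + 1)⁻¹ * A := by rw [mul_comm, Finset.sum_mul]
    _ ≤ ∑ k ∈ Finset.range n, M * N₀ * ∑ i ∈ Finset.range N₀, u (k + i) :=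
        Finset.sum_le_sum h_term
    _ = M * N₀ * ∑ i ∈ Finset.range N₀, ∑ k ∈ Finset.range n, u (k + i) := by
        rw [← Finset.mul_sum, Finset.sum_comm]
    _ ≤ M * N₀ * ∑ _i ∈ Finset.range N₀, ∑ k ∈ Finset.range (n + n), u k := by
        gcongr with i hi
        exact sum_range_add_le (u := u) (fun k => mul_nonneg (by positivity) (hw k))
          ((Finset.mem_range.1 hi).le.trans hN₀) n
    _ = M * N₀ ^ 2 * ∑ k ∈ Finset.range (2 * n), u k := by
        rw [Finset.sum_const, Finset.card_range, nsmul_eq_mul, two_mul]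
        ring

theorem log_natCast_le_two_mul_log_half_add_one (N : ℕ) :
    Real.log N ≤ 2 * Real.log ((N / 2 : ℕ) + 1) := by
  rcases N.eq_zero_or_pos with rfl | hN
  · simp
  have h : N ≤ (N / 2 + 1) ^ 2 := by nlinarith [Nat.div_add_mod N 2, N.mod_lt two_pos]
  refine (Real.log_le_log (by positivity) (by exact_mod_cast h :
    (N : ℝ) ≤ ((N / 2 : ℕ) + 1) ^ 2)).trans_eq ?_
  rw [Real.log_pow, Nat.cast_ofNat]

theorem cos_mul_norm_mul_log_le_norm_sum {c : ℕ → ℂ} {θ M : ℝ} (hθ : θ ≤ π)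
    (hcos : 0 ≤ Real.cos θ) (hc : ∀ n, 1 ≤ n → c n ∈ sectorK θ) (hM : 0 ≤ M) {N₀ N : ℕ}
    (hN : N₀ ≤ N / 2) (h : ∀ m, 1 ≤ m → m ≤ N → N ≤ 2 * m + 1 →
      ‖c N‖ ≤ M * ∑ i ∈ Finset.range N₀, ‖c (m + i)‖) :
    Real.cos θ * (‖c N‖ * Real.log N) ≤ 2 * M * N₀ ^ 2 *
      ‖∑ k ∈ Finset.range (2 * (N / 2)), ((k : ℂ) + 1)⁻¹ * c (N / 2 + 1 + k)‖ := by
  have h_log := mul_log_le_sum_inv_mul (w := fun k => ‖c (N / 2 + 1 + k)‖)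
    (fun _ => norm_nonneg _) (norm_nonneg (c N)) hM hN fun k hk => by
      simpa only [add_assoc] using h (N / 2 + 1 + k) (by lia) (by lia) (by lia)
  have h_sector := cos_mul_sum_norm_le_norm_sum hθ (s := Finset.range (2 * (N / 2)))
    (a := fun k => ((k : ℝ) + 1)⁻¹) (z := fun k => c (N / 2 + 1 + k))
    (fun k _ => by positivity) fun k _ => hc _ (by lia)
  push_cast at h_sector
  calc Real.cos θ * (‖c N‖ * Real.log N)
      ≤ Real.cos θ * (‖c N‖ * (2 * Real.log ((N / 2 : ℕ) + 1))) := by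
        gcongr
        exact log_natCast_le_two_mul_log_half_add_one N
    _ = 2 * (Real.cos θ * (‖c N‖ * Real.log ((N / 2 : ℕ) + 1))) := by ring
    _ ≤ 2 * (Real.cos θ * (M * N₀ ^ 2 * ∑ k ∈ Finset.range (2 * (N / 2)),
          ((k : ℝ) + 1)⁻¹ * ‖c (N / 2 + 1 + k)‖)) := by gcongr
    _ = 2 * M * N₀ ^ 2 * (Real.cos θ * ∑ k ∈ Finset.range (2 * (N / 2)),
          ((k : ℝ) + 1)⁻¹ * ‖c (N / 2 + 1 + k)‖) := by ring
    _ ≤ _ := by gcongr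

theorem IsGBV.exists_norm_mul_log_le {c : ℕ → ℂ} (hc : IsGBV c) {ψ : ℕ → ℝ} {D K : ℝ} (hD : 0 < D)
    (hK : 0 < K) (hψ : ∀ n, 0 ≤ ψ n) (hdbl : ∀ m N, N ≤ 2 * m + 1 → ψ m ≤ K * ψ N)
    (hsum : ∀ n, ‖∑ k ∈ Finset.range (2 * n), ((k : ℂ) + 1)⁻¹ * c (n + 1 + k)‖ ≤ D * ψ n)
    (hle : ∀ n, ‖c (n + 1)‖ ≤ D * ψ n) :
    ∃ C : ℝ, 0 < C ∧ ∀ N : ℕ, 1 ≤ N → ‖c N‖ * Real.log N ≤ C * ψ N := by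
  obtain ⟨N₀, hN₀, M, hM, hvar⟩ := hc.exists_norm_add_sum_Ico_le
  obtain ⟨θ, hθ0, hθ, hsec⟩ := hc.1
  have hcos : 0 < Real.cos θ := Real.cos_pos_of_mem_Ioo ⟨by linarith, hθ⟩
  have : (0 : ℝ) < N₀ := by exact_mod_cast hN₀
  have h_dbl : ∀ m N, N ≤ 2 * m + 1 → D * ψ m ≤ D * (K * ψ N) := fun m N hmN =>
    mul_le_mul_of_nonneg_left (hdbl m N hmN) hD.le
  refine ⟨max (2 * M * N₀ ^ 2 * D * K / Real.cos θ) (D * K * Real.log (2 * N₀)),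
    lt_max_of_lt_left (by positivity), fun N hN => ?_⟩
  rcases le_or_gt N₀ (N / 2) with h_large | h_small
  · refine le_trans ?_ (mul_le_mul_of_nonneg_right (le_max_left _ _) (hψ N))
    rw [div_mul_eq_mul_div, le_div_iff₀' hcos]
    calc Real.cos θ * (‖c N‖ * Real.log N)
        ≤ 2 * M * N₀ ^ 2 *
          ‖∑ k ∈ Finset.range (2 * (N / 2)), ((k : ℂ) + 1)⁻¹ * c (N / 2 + 1 + k)‖ :=
          cos_mul_norm_mul_log_le_norm_sum (by linarith [Real.pi_pos]) hcos.le hsec hM.le h_large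
            fun m hm hmN hNm => (le_add_of_nonneg_right (by positivity)).trans
              (hvar m N hm hmN hNm)
      _ ≤ 2 * M * N₀ ^ 2 * (D * (K * ψ N)) := by
          gcongr
          exact (hsum _).trans (h_dbl _ _ (by lia))
      _ = 2 * M * N₀ ^ 2 * D * K * ψ N := by ring
  · refine le_trans ?_ (mul_le_mul_of_nonneg_right (le_max_right _ _) (hψ N))
    obtain ⟨n, rfl⟩ := Nat.exists_eq_add_of_le' hN
    have h_log : Real.log ((n + 1 : ℕ) : ℝ) ≤ Real.log (2 * N₀) :=
      Real.log_le_log (by positivity) (by exact_mod_cast (by lia : n + 1 ≤ 2 * N₀))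
    refine (mul_le_mul ((hle n).trans (h_dbl n (n + 1) (by lia))) h_log
      (Real.log_natCast_nonneg _) (mul_nonneg hD.le (mul_nonneg hK.le (hψ _)))).trans_eq ?_
    ring

theorem log_mul_sum_norm_le {E : Type*} [SeminormedAddCommGroup E] {c : ℕ → E} {ψ : ℕ → ℝ}
    {C : ℝ} (hC : 0 ≤ C) (hψ : Antitone ψ)
    (h : ∀ n : ℕ, 1 ≤ n → ‖c n‖ * Real.log n ≤ C * ψ n) (n N₀ : ℕ) :
    Real.log (n + 1) * ∑ i ∈ Finset.range N₀, ‖c (n + 1 + i)‖ ≤ N₀ * (C * ψ n) := by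
  rw [Finset.mul_sum]
  refine (Finset.sum_le_card_nsmul _ _ (C * ψ n) fun i _ => ?_).trans_eq
    (by rw [Finset.card_range, nsmul_eq_mul])
  calc Real.log (n + 1) * ‖c (n + 1 + i)‖
      ≤ ‖c (n + 1 + i)‖ * Real.log ((n + 1 + i : ℕ) : ℝ) := by
        rw [mul_comm]
        gcongr
        exact_mod_cast Nat.le_add_right (n + 1) i
    _ ≤ C * ψ (n + 1 + i) := h _ (by lia)
    _ ≤ C * ψ n := mul_le_mul_of_nonneg_left (hψ (by lia)) hC

theorem IsGBV.exists_normL_expBlock_le {c : ℕ → ℂ} (hc : IsGBV c) {ψ : ℕ → ℝ} {C : ℝ} (hC : 0 < C)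
    (hψ : Antitone ψ) (h : ∀ n : ℕ, 1 ≤ n → ‖c n‖ * Real.log n ≤ C * ψ n) :
    ∃ B : ℝ, 0 < B ∧ ∀ n L : ℕ, L ≤ n → normL (expBlock c n L) ≤ B * ψ n := by
  obtain ⟨N₀, hN₀, M, hM, hvar⟩ := hc.exists_norm_add_sum_Ico_le
  have : (0 : ℝ) < N₀ := by exact_mod_cast hN₀
  refine ⟨8 * (1 + π) * M * (N₀ * C), by positivity, fun n L hL => ?_⟩
  have hlog : 0 ≤ Real.log ((n : ℝ) + 1) := by exact_mod_cast Real.log_natCast_nonneg (n + 1)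
  have h_var := hvar (n + 1) (n + 1 + (L - 1)) (by lia) (by lia) (by lia)
  rw [Finset.sum_Ico_eq_sum_range, add_tsub_cancel_left] at h_var
  calc normL (expBlock c n L)
      ≤ 8 * (1 + π) * Real.log (n + 1) * (‖c (n + 1 + (L - 1))‖ +
          ∑ i ∈ Finset.range (L - 1), ‖c (n + 1 + i) - c (n + 1 + (i + 1))‖) :=
        normL_sum_smul_expZ_le (fun j => c (n + 1 + j)) (n + 1) hL
    _ ≤ 8 * (1 + π) * Real.log (n + 1) * (M * ∑ i ∈ Finset.range N₀, ‖c (n + 1 + i)‖) :=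
        mul_le_mul_of_nonneg_left h_var (by positivity)
    _ = 8 * (1 + π) * M * (Real.log (n + 1) * ∑ i ∈ Finset.range N₀, ‖c (n + 1 + i)‖) := by ring
    _ ≤ 8 * (1 + π) * M * (N₀ * (C * ψ n)) :=
        mul_le_mul_of_nonneg_left (log_mul_sum_norm_le hC.le hψ h n N₀) (by positivity)
    _ = 8 * (1 + π) * M * (N₀ * C) * ψ n := by ring

/-! ### The equivalence -/

theorem jacksonRate_nonneg (r : ℕ) (g : ℝ → ℂ) (n : ℕ) : 0 ≤ jacksonRate r g n :=
  mul_nonneg (by positivity) (modulusL_nonneg _ _)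

theorem jacksonRate_antitone (r : ℕ) {g : ℝ → ℂ} (hg : IsL2Pi g) :
    Antitone (jacksonRate r g) := fun m n hmn => by
  have h_inv : ((n : ℝ) + 1)⁻¹ ≤ ((m : ℝ) + 1)⁻¹ := by gcongr
  simp only [jacksonRate, zpow_neg, zpow_natCast, ← inv_pow]
  exact mul_le_mul (pow_le_pow_left₀ (by positivity) h_inv r) (modulusL_mono hg h_inv)
    (modulusL_nonneg _ _) (by positivity)

theorem jacksonRate_le_two_pow_mul (r : ℕ) {g : ℝ → ℂ} (hg : IsL2Pi g) {m N : ℕ}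
    (h : N ≤ 2 * m + 1) : jacksonRate r g m ≤ 2 ^ (r + 1) * jacksonRate r g N := by
  have h_le : (N : ℝ) + 1 ≤ (m + 1) * 2 := by exact_mod_cast (by lia : N + 1 ≤ (m + 1) * 2)
  have h_inv : ((m : ℝ) + 1)⁻¹ ≤ 2 * ((N : ℝ) + 1)⁻¹ := by
    rwa [← div_eq_mul_inv, le_div_iff₀ (by positivity), inv_mul_le_iff₀ (by positivity)]
  have h_modulus : modulusL g ((m : ℝ) + 1)⁻¹ ≤ 2 * modulusL g ((N : ℝ) + 1)⁻¹ :=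
    (modulusL_mono hg h_inv).trans
      (by exact_mod_cast modulusL_nat_mul_le hg ((N : ℝ) + 1)⁻¹ two_ne_zero)
  simp only [jacksonRate, zpow_neg, zpow_natCast, ← inv_pow]
  calc ((m : ℝ) + 1)⁻¹ ^ r * modulusL g ((m : ℝ) + 1)⁻¹
      ≤ (2 * ((N : ℝ) + 1)⁻¹) ^ r * (2 * modulusL g ((N : ℝ) + 1)⁻¹) :=
        mul_le_mul (pow_le_pow_left₀ (by positivity) h_inv r) h_modulus (modulusL_nonneg _ _)
          (by positivity)
    _ = 2 ^ (r + 1) * (((N : ℝ) + 1)⁻¹ ^ r * modulusL g ((N : ℝ) + 1)⁻¹) := by ring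

theorem fhat_sub_partialSum {f : ℝ → ℂ} (hf : IsL2Pi f) (n : ℕ) (k : ℤ) :
    fhat (f - partialSum f n) k = if k.natAbs ≤ n then 0 else fhat f k := by
  rw [fhat_sub hf (isL2Pi_partialSum f n), partialSum_eq_sum_smul, fhat_sum_smul_expZ]
  have h_mem : k ∈ Finset.Icc (-(n : ℤ)) n ↔ k.natAbs ≤ n := by
    rw [Finset.mem_Icc]
    lia
  simp only [h_mem]
  split_ifs
  · exact sub_self _
  · exact sub_zero _

theorem partialSum_comp_neg (f : ℝ → ℂ) (n : ℕ) :
    partialSum (fun x => f (-x)) n = fun x => partialSum f n (-x) := by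
  funext x
  simp only [partialSum_eq_sum_smul, Finset.sum_apply, Pi.smul_apply, fhat_comp_neg,
    expZ_apply_neg]
  exact Finset.sum_equiv (Equiv.neg ℤ) (fun k => by
    rw [Equiv.neg_apply, Finset.mem_Icc, Finset.mem_Icc]
    lia) fun k _ => by rw [Equiv.neg_apply, neg_neg]

theorem norm_sum_inv_mul_fhat_le {f : ℝ → ℂ} (hf : IsL2Pi f) (n : ℕ) :
    ‖∑ k ∈ Finset.range (2 * n), ((k : ℂ) + 1)⁻¹ * fhat f (n + 1 + k : ℕ)‖ ≤
      2 * normL (f - partialSum f n) := by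
  have h_bound :=
    norm_sum_inv_mul_fhat_sub_le (hf.sub (isL2Pi_partialSum f n)) n (2 * n)
  have h_term : ∀ k ∈ Finset.range (2 * n), ((k : ℂ) + 1)⁻¹ *
      (fhat (f - partialSum f n) (n + (k + 1)) - fhat (f - partialSum f n) (n - (k + 1))) =
        ((k : ℂ) + 1)⁻¹ * fhat f (n + 1 + k : ℕ) := fun k hk => by
    rw [Finset.mem_range] at hk
    rw [fhat_sub_partialSum hf, fhat_sub_partialSum hf, if_neg (by lia), if_pos (by lia), sub_zero]
    congr 2
    lia
  rwa [Finset.sum_congr rfl h_term] at h_bound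

theorem exists_norm_fhat_mul_log_le {f : ℝ → ℂ} (hf : IsL2Pi f)
    (hpos : IsGBV fun n : ℕ => fhat f n) {ψ : ℕ → ℝ} {C K : ℝ} (hC : 0 < C) (hK : 0 < K)
    (hψ : ∀ n, 0 ≤ ψ n) (hdbl : ∀ m N, N ≤ 2 * m + 1 → ψ m ≤ K * ψ N)
    (h : ∀ n, normL (f - partialSum f n) ≤ C * ψ n) :
    ∃ C' : ℝ, 0 < C' ∧ ∀ N : ℕ, 1 ≤ N → ‖fhat f N‖ * Real.log N ≤ C' * ψ N := by
  refine hpos.exists_norm_mul_log_le (D := 2 * C) (by positivity) hK hψ hdbl (fun n => ?_)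
    fun n => ?_
  · linarith [norm_sum_inv_mul_fhat_le hf n, h n]
  · have h_coeff := norm_fhat_le (hf.sub (isL2Pi_partialSum f n)) (n + 1 : ℕ)
    rw [fhat_sub_partialSum hf, if_neg (by lia)] at h_coeff
    linarith [h n, normL_nonneg (f - partialSum f n)]

theorem exists_normL_sub_partialSum_le {f : ℝ → ℂ} (hf : IsL2Pi f)
    (hpos : IsGBV fun n : ℕ => fhat f n) (hneg : IsGBV fun n : ℕ => fhat f (-n))
    {ψ : ℕ → ℝ} {C J : ℝ} (hC : 0 < C) (hJ : 0 ≤ J) (hψ : Antitone ψ)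
    (hjackson : ∀ n, ∃ T ∈ trigPoly n, normL (f - T) ≤ J * ψ n)
    (hlog_pos : ∀ n : ℕ, 1 ≤ n → ‖fhat f n‖ * Real.log n ≤ C * ψ n)
    (hlog_neg : ∀ n : ℕ, 1 ≤ n → ‖fhat f (-n)‖ * Real.log n ≤ C * ψ n) :
    ∃ C' : ℝ, 0 < C' ∧ ∀ n, normL (f - partialSum f n) ≤ C' * ψ n := by
  obtain ⟨B₁, hB₁, h_pos⟩ := hpos.exists_normL_expBlock_le hC hψ hlog_pos
  obtain ⟨B₂, hB₂, h_neg⟩ := hneg.exists_normL_expBlock_le hC hψ hlog_neg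
  refine ⟨3 * J + (B₁ + B₂), by positivity, fun n => ?_⟩
  obtain ⟨T, hT, hTle⟩ := hjackson n
  calc normL (f - partialSum f n)
      = normL ((f - vpMean f n) + (vpMean f n - partialSum f n)) := by rw [sub_add_sub_cancel]
    _ ≤ normL (f - vpMean f n) + normL (vpMean f n - partialSum f n) :=
        normL_add_le (hf.sub (isL2Pi_vpMean f n))
          ((isL2Pi_vpMean f n).sub (isL2Pi_partialSum f n))
    _ ≤ 3 * (J * ψ n) + (B₁ * ψ n + B₂ * ψ n) := by
        gcongr
        · exact (normL_sub_vpMean_le hf hT).trans (by linarith)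
        · exact normL_vpMean_sub_partialSum_le f (h_pos n) (h_neg n)
    _ = (3 * J + (B₁ + B₂)) * ψ n := by ring

theorem exists_normL_sub_partialSum_le_iff {f : ℝ → ℂ} (hf : IsL2Pi f)
    (hpos : IsGBV fun n : ℕ => fhat f n) (hneg : IsGBV fun n : ℕ => fhat f (-n))
    {ψ : ℕ → ℝ} {J K : ℝ} (hJ : 0 ≤ J) (hK : 0 < K) (hψ0 : ∀ n, 0 ≤ ψ n) (hψ : Antitone ψ)
    (hdbl : ∀ m N, N ≤ 2 * m + 1 → ψ m ≤ K * ψ N)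
    (hjackson : ∀ n, ∃ T ∈ trigPoly n, normL (f - T) ≤ J * ψ n) :
    (∃ C : ℝ, 0 < C ∧ ∀ n, normL (f - partialSum f n) ≤ C * ψ n) ↔
      ∃ C : ℝ, 0 < C ∧ ∀ n : ℤ, n ≠ 0 → ‖fhat f n‖ * Real.log n.natAbs ≤ C * ψ n.natAbs := by
  refine ⟨fun ⟨C, hC, h⟩ => ?_, fun ⟨C, hC, h⟩ => ?_⟩
  · have h_refl : ∀ n, normL ((fun x => f (-x)) - partialSum (fun x => f (-x)) n) ≤ C * ψ n :=
      fun n => by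
        rw [partialSum_comp_neg]
        exact (normL_comp_neg (f - partialSum f n)).trans_le (h n)
    obtain ⟨C₁, hC₁, h_pos⟩ := exists_norm_fhat_mul_log_le hf hpos hC hK hψ0 hdbl h
    obtain ⟨C₂, -, h_neg⟩ := exists_norm_fhat_mul_log_le hf.comp_neg
      (by simpa only [fhat_comp_neg] using hneg) hC hK hψ0 hdbl h_refl
    simp only [fhat_comp_neg] at h_neg
    refine ⟨max C₁ C₂, lt_max_of_lt_left hC₁, fun n hn => ?_⟩
    rcases n.eq_nat_or_neg with ⟨N, rfl | rfl⟩
    · rw [Int.natAbs_natCast]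
      exact (h_pos N (by lia)).trans (mul_le_mul_of_nonneg_right (le_max_left _ _) (hψ0 N))
    · rw [Int.natAbs_neg, Int.natAbs_natCast]
      exact (h_neg N (by lia)).trans (mul_le_mul_of_nonneg_right (le_max_right _ _) (hψ0 N))
  · exact exists_normL_sub_partialSum_le hf hpos hneg hC hJ hψ hjackson
      (fun n hn => by simpa using h n (by lia)) fun n hn => by simpa using h (-n) (by lia)

theorem norm_mul_log_abs_intCast (z : ℂ) (n : ℤ) :
    ‖z * ((Real.log |(n : ℝ)| : ℝ) : ℂ)‖ = ‖z‖ * Real.log (n.natAbs : ℝ) := by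
  rw [norm_mul, Complex.norm_real, ← Int.cast_abs, Int.abs_eq_natAbs, Int.cast_natCast,
    Real.norm_of_nonneg (Real.log_natCast_nonneg _)]

theorem corollary3_general (f : ℝ → ℂ) (hf : IsL2Pi f)
    (hpos : IsGBV fun n : ℕ => fhat f (n : ℤ))
    (hneg : IsGBV fun n : ℕ => fhat f (-(n : ℤ)))
    (r : ℕ) (hAC : ∀ k : ℕ, k < r → IsLocallyAC (iteratedDeriv k f)) :
    (∃ C : ℝ, 0 < C ∧ ∀ n : ℕ,
      normL (fun x => f x - partialSum f n x) ≤
        C * (((n : ℝ) + 1) ^ (-(r : ℤ)) * modulusL (iteratedDeriv r f) (((n : ℝ) + 1)⁻¹))) ↔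
    (∃ C : ℝ, 0 < C ∧ ∀ n : ℤ, n ≠ 0 →
      ‖fhat f n * ((Real.log |(n : ℝ)| : ℝ) : ℂ)‖ ≤
        C * ((|(n : ℝ)| + 1) ^ (-(r : ℤ)) *
          modulusL (iteratedDeriv r f) ((|(n : ℝ)| + 1)⁻¹))) := by
  have hg : IsL2Pi (iteratedDeriv r f) := isL2Pi_iteratedDeriv hf hAC
  obtain ⟨J, hJ, h_jackson⟩ := exists_forall_mem_trigPoly_normL_sub_le_jacksonRate r
  have h_iff := exists_normL_sub_partialSum_le_iff hf hpos hneg hJ (K := 2 ^ (r + 1))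
    (by positivity) (jacksonRate_nonneg r _) (jacksonRate_antitone r hg)
    (fun _ _ => jacksonRate_le_two_pow_mul r hg) (h_jackson f hf hAC)
  have h_rate : ∀ n : ℤ, (|(n : ℝ)| + 1) ^ (-(r : ℤ)) *
      modulusL (iteratedDeriv r f) ((|(n : ℝ)| + 1)⁻¹) =
        jacksonRate r (iteratedDeriv r f) n.natAbs := fun n => by
    rw [jacksonRate, ← Int.cast_abs, Int.abs_eq_natAbs, Int.cast_natCast]
  simp only [norm_mul_log_abs_intCast, h_rate]
  exact h_iff

theorem corollary3 (f : ℝ → ℂ) (hf : IsL2Pi f)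
    (hpos : IsGBV fun n : ℕ => fhat f (n : ℤ))
    (hneg : IsGBV fun n : ℕ => fhat f (-(n : ℤ)))
    (r : ℕ) (hr : 1 ≤ r) (hAC : ∀ k : ℕ, k < r → IsLocallyAC (iteratedDeriv k f)) :
    (∃ C : ℝ, 0 < C ∧ ∀ n : ℕ,
      normL (fun x => f x - partialSum f n x) ≤
        C * (((n : ℝ) + 1) ^ (-(r : ℤ)) * modulusL (iteratedDeriv r f) (((n : ℝ) + 1)⁻¹))) ↔
    (∃ C : ℝ, 0 < C ∧ ∀ n : ℤ, n ≠ 0 →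
      ‖fhat f n * ((Real.log |(n : ℝ)| : ℝ) : ℂ)‖ ≤
        C * ((|(n : ℝ)| + 1) ^ (-(r : ℤ)) *
          modulusL (iteratedDeriv r f) ((|(n : ℝ)| + 1)⁻¹))) :=
  corollary3_general f hf hpos hneg r hAC
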